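/- **Setting.** Let $d\ge 1$, $\mathbb T=\mathbb R/\mathbb Z$, and let $d_{\rm flat},d_{\rm anlyt}\ge 0$ with $d_{\rm flat}+d_{\rm anlyt}\le d$. Call an index $i\in\{1,\dots,d\}$ *flat* if $i\le d_{\rm flat}$, *analytic* if $i>d-d_{\rm anlyt}$, and *intermediate* otherwise. For $\mu\in[0,\infty)^d$ and $\varepsilon\in\mathbb R$ consider on $T^*\mathbb T^d=\mathbb T^d\times\mathbb R^d$ the Hamiltonians $$H_0(x,p)=\sum_{i=1}^d\Big(\frac{p_i^2}{2}-\mu_iV_i(x^i)\Big),\qquad H_\varepsilon(x,p)=H_0(x,p)+\varepsilon U(x),$$ where each $V_i\in C^2(\mathbb T)$ is a Morse function or constant, $\min V_i=0$, $\|V_i\|_{C^0}\le C_i$, and $U\in C^2(\mathbb T^d)$ is real-valued with absolutely convergent Fourier series $U(x)=\sum_{k\in\mathbb Z^d}U_k e^{2\pi \mathrm i k\cdot x}$. Put $\mathcal S_U=\{k:U_k\ne 0\}$, let $\deg_U^{(i)}$ be the least $D\in\mathbb N_0$ with $|k_i|\le D$ for all $k\in\mathcal S_U$ (if there is one), and let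 $\mathcal B_0$ be the set of all $b\in\mathbb Z^d$ with coprime entries, $b_i\neq 0$ for all $i$, and $b\cdot k=0$ for some $0\ne k\in\mathcal S_U$. Let $\mathfrak c(V)=\int_0^1\sqrt{2V(x)}\,dx$, and let $\alpha_\varepsilon$ denote Mather's $\alpha$-function of $H_\varepsilon$. For $b\in\mathcal B_0$, a $b$-torus of $H_0$ of class $c\in\mathbb R^d$ and energy $e$ is an invariant graph $\{(x,c+\nabla u_c(x))\}\subset\{H_0=e\}$ with $u_c\in C^{1,1}(\mathbb T^d)$ and $|c_i|>\sqrt{\mu_i}\,\mathfrak c(V_i)$ for all $i$, on which the flow of $H_0$ is conjugate, by a diffeomorphism from $\mathbb T^d$ onto the graph whose projection to $\mathbb T^d$ is a diffeomorphism homotopic to the identity, to the rotation $\theta\mapsto\theta+t\omega$ with $\omega$ a non-zero multiple of $b$. **Assumption (P$'$) at energy $e$ for a set $\Lambda\subset[0,\infty)^d$ of parameters.** For every $b\in\mathcal B_0$ there is a sequence $\varepsilon_n\to0$, $\varepsilon_n\ne0$, such that for every $\mu\in\Lambda$ there is a $b$-torus of $H_0$ of energy $e$, of some class $c$, which is preserved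 in the following sense: there are $u_n\in C^{1,1}(\mathbb T^d)$ whose graphs $\{(x,c+\nabla u_n(x))\}$ are invariant under the flow of $H_{\varepsilon_n}$ and which solve $$H_{\varepsilon_n}(x,c+\nabla u_n(x))=\alpha_{\varepsilon_n}(c)\quad\text{for all }x\in\mathbb T^d,$$ and there are $u^{(0)},u^{(1)}\in C^{1,1}(\mathbb T^d)$ and $a^{(0)},a^{(1)}\in\mathbb R$ with $u_n=u^{(0)}+\varepsilon_nu^{(1)}+O(\varepsilon_n^2)$ in $C^{1,1}(\mathbb T^d)$ and $\alpha_{\varepsilon_n}(c)=a^{(0)}+\varepsilon_na^{(1)}+O(\varepsilon_n^2)$. **Theorem.** Let $e>0$. For every non-flat index $k$ there is a threshold $\tau_k>0$, depending only on $C_k$, $\deg_U^{(d_{\rm flat}+1)},\dots,\deg_U^{(d)}$ and $e$ (and on $d,d_{\rm flat},d_{\rm anlyt}$), such that the following holds. Suppose that $U$ is a trigonometric polynomial in the non-flat variables, i.e. $\deg_U^{(i)}<\infty$ for all $i>d_{\rm flat}$, and that $V_j$ is real-analytic for every analytic index $j$. Let $\tilde\mu\in[0,\infty)^d$ with $\tilde\mu_i=0$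 for flat $i$ and $\tilde\mu_k\le\tau_k$ for intermediate $k$ (there is no size restriction on $\tilde\mu_j$ for analytic $j$). Then for every choice $s$ of the intermediate parameters $(\mu_{d_{\rm flat}+1},\dots,\mu_{d-d_{\rm anlyt}})$ there is a $d_{\rm anlyt}$-dimensional Lebesgue null set $N(s)\subset\mathbb R^{d_{\rm anlyt}}$ (empty if $d_{\rm anlyt}=0$) such that: if (P$'$) holds at energy $e$ for some $\Lambda\subset\prod_{i=1}^d[0,\tilde\mu_i]$ (for instance for the whole box), and if some $\mu\in\Lambda$ satisfies $$(\mu_{d-d_{\rm anlyt}+1},\dots,\mu_d)\notin N(\mu_{d_{\rm flat}+1},\dots,\mu_{d-d_{\rm anlyt}}),$$ then $U$ is separable: there are $U_1,\dots,U_d\in C^2(\mathbb T)$ with $$U(x^1,\dots,x^d)=U_1(x^1)+\dots+U_d(x^d)\qquad\text{for all }x\in\mathbb T^d.$$ -/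

import Mathlib

open MeasureTheory Filter Topology

/-! Functions on the torus `𝕋^d = ℝ^d / ℤ^d` are functions on `UnitAddTorus (Fin d)`; regularity and
derivatives are those of the `ℤ^d`-periodic lift to `ℝ^d`. -/

namespace LiouvilleRigidity

/-- The covering projection `ℝ^d → 𝕋^d`. -/
def proj {d : ℕ} (x : Fin d → ℝ) : UnitAddTorus (Fin d) := fun i => (x i : UnitAddCircle)

/-- The periodic lift to `ℝ^d` of a function on `𝕋^d`. -/
def lift {d : ℕ} (f : UnitAddTorus (Fin d) → ℝ) (x : Fin d → ℝ) : ℝ := f (proj x)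

/-- The periodic lift to `ℝ` of a function on the circle. -/
def lift₁ (V : UnitAddCircle → ℝ) (x : ℝ) : ℝ := V (x : UnitAddCircle)

/-- The gradient of a function on `𝕋^d`, as a function on the cover `ℝ^d`. -/
noncomputable def grad {d : ℕ} (f : UnitAddTorus (Fin d) → ℝ) (x : Fin d → ℝ) : Fin d → ℝ :=
  fun i => fderiv ℝ (lift f) x (Pi.single i 1)

/-- `f ∈ C^{1,1}(𝕋^d)`. -/
def IsC11 {d : ℕ} (f : UnitAddTorus (Fin d) → ℝ) : Prop :=
  ContDiff ℝ 1 (lift f) ∧ ∃ K, LipschitzWith K (fderiv ℝ (lift f))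

/-- `f` has `C^{1,1}`-norm at most `K`: `|f|`, `|Df|` and the Lipschitz constant of `Df` are at
most `K`. -/
def C11NormLE {d : ℕ} (f : UnitAddTorus (Fin d) → ℝ) (K : ℝ) : Prop :=
  ContDiff ℝ 1 (lift f) ∧ (∀ x, |f x| ≤ K) ∧ (∀ x, ‖fderiv ℝ (lift f) x‖ ≤ K) ∧
    ∀ x y, ‖fderiv ℝ (lift f) x - fderiv ℝ (lift f) y‖ ≤ K * ‖x - y‖

/-! ### The potentials -/

/-- A Morse function on the circle: all critical points are non-degenerate. -/
def IsMorse (V : UnitAddCircle → ℝ) : Prop :=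
  ∀ x : ℝ, deriv (lift₁ V) x = 0 → deriv (deriv (lift₁ V)) x ≠ 0

/-- The potentials of the unperturbed system: `C²`, Morse or constant, with `min V = 0` and
`‖V‖_{C⁰} ≤ C`. -/
structure IsPotential (V : UnitAddCircle → ℝ) (C : ℝ) : Prop where
  contDiff : ContDiff ℝ 2 (lift₁ V)
  morse_or_const : IsMorse V ∨ ∃ a, ∀ x, V x = a
  nonneg : ∀ x, 0 ≤ V x
  min_eq_zero : ∃ x, V x = 0
  norm_le : ∀ x, |V x| ≤ C

/-- Real-analyticity of a function on the circle. -/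
def IsAnalytic (V : UnitAddCircle → ℝ) : Prop := AnalyticOnNhd ℝ (lift₁ V) Set.univ

/-- `𝔠(V) = ∫₀¹ √(2 V(x)) dx`. -/
noncomputable def criticalClass (V : UnitAddCircle → ℝ) : ℝ :=
  ∫ x : ℝ in (0 : ℝ)..1, Real.sqrt (2 * lift₁ V x)

/-- The perturbing potentials: `C²` with absolutely convergent Fourier series. -/
structure IsPerturbation {d : ℕ} (U : UnitAddTorus (Fin d) → ℝ) : Prop where
  contDiff : ContDiff ℝ 2 (lift U)
  summable : Summable fun k : Fin d → ℤ => ‖UnitAddTorus.mFourierCoeff (fun x => (U x : ℂ)) k‖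

/-- The total potential energy `-∑ μ_i V_i(x^i) + ε U(x)` of `H_ε`. -/
def energyPotential {d : ℕ} (V : Fin d → UnitAddCircle → ℝ) (μ : Fin d → ℝ)
    (U : UnitAddTorus (Fin d) → ℝ) (ε : ℝ) (x : UnitAddTorus (Fin d)) : ℝ :=
  -(∑ i, μ i * V i (x i)) + ε * U x

/-! ### Mechanical Hamiltonians on `T*𝕋^d = 𝕋^d × ℝ^d` and Mather's `α`-function -/

/-- The Hamiltonian `∑ p_i²/2 + W(x)`. -/
noncomputable def hamiltonian {d : ℕ} (W : UnitAddTorus (Fin d) → ℝ) (x : UnitAddTorus (Fin d))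
    (p : Fin d → ℝ) : ℝ :=
  (∑ i, p i ^ 2 / 2) + W x

/-- The Lagrangian `∑ v_i²/2 - W(x)`. -/
noncomputable def lagrangian {d : ℕ} (W : UnitAddTorus (Fin d) → ℝ) (x : UnitAddTorus (Fin d))
    (v : Fin d → ℝ) : ℝ :=
  (∑ i, v i ^ 2 / 2) - W x

/-- `t ↦ (γ t, p t)` is (a lift to `ℝ^d × ℝ^d` of) a trajectory of the Hamiltonian
`∑ p_i²/2 + W(x)`: `γ' = p`, `p' = -∇W(γ)`.  As the Legendre transform is `v = p`, these are also
the trajectories of the Euler-Lagrange flow. -/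
def IsTrajectory {d : ℕ} (W : UnitAddTorus (Fin d) → ℝ) (γ p : ℝ → Fin d → ℝ) : Prop :=
  ∀ t, HasDerivAt γ (p t) t ∧ HasDerivAt p (-grad W (γ t)) t

/-- `Φ` is the flow of `∑ p_i²/2 + W(x)` on `𝕋^d × ℝ^d`. -/
def IsFlow {d : ℕ} (W : UnitAddTorus (Fin d) → ℝ)
    (Φ : ℝ → UnitAddTorus (Fin d) × (Fin d → ℝ) → UnitAddTorus (Fin d) × (Fin d → ℝ)) : Prop :=
  ∀ z, ∃ γ p, IsTrajectory W γ p ∧ (proj (γ 0), p 0) = z ∧ ∀ t, Φ t z = (proj (γ t), p t)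

/-- The invariant probability measures with finite average action. -/
def IsInvariantMeasure {d : ℕ} (W : UnitAddTorus (Fin d) → ℝ)
    (ν : Measure (UnitAddTorus (Fin d) × (Fin d → ℝ))) : Prop :=
  IsProbabilityMeasure ν ∧ (∃ Φ, IsFlow W Φ ∧ ∀ t, MeasurePreserving (Φ t) ν ν) ∧
    Integrable (fun z => lagrangian W z.1 z.2) ν

/-- Mather's `α`-function `α(c) = -min_ν ∫ (L - ⟨c, v⟩) dν`, the minimum being taken over the
invariant probability measures of finite action. -/
noncomputable def matherAlpha {d : ℕ} (W : UnitAddTorus (Fin d) → ℝ) (c : Fin d → ℝ) : ℝ :=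
  -sInf {A : ℝ | ∃ ν, IsInvariantMeasure W ν ∧
    A = ∫ z, (lagrangian W z.1 z.2 - ∑ i, c i * z.2 i) ∂ν}

/-- `u` is a classical solution of `H(x, c + ∇u) = a`. -/
def SolvesHJ {d : ℕ} (W : UnitAddTorus (Fin d) → ℝ) (c : Fin d → ℝ)
    (u : UnitAddTorus (Fin d) → ℝ) (a : ℝ) : Prop :=
  ∀ x : Fin d → ℝ, hamiltonian W (proj x) (c + grad u x) = a

/-- The graph `{(x, c + ∇u(x))}` is invariant under the Hamiltonian flow. -/
def IsInvariantGraph {d : ℕ} (W : UnitAddTorus (Fin d) → ℝ) (c : Fin d → ℝ)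
    (u : UnitAddTorus (Fin d) → ℝ) : Prop :=
  ∀ γ p, IsTrajectory W γ p → p 0 = c + grad u (γ 0) → ∀ t, p t = c + grad u (γ t)

/-- The flow on the graph `{(x, c + ∇u(x))}` is conjugate to the rotation `θ ↦ θ + t ω` of `𝕋^d`.
The conjugacy is `θ ↦ (X θ, c + ∇u(X θ))` with a `C¹`-diffeomorphism `X` of `𝕋^d` homotopic to the
identity, so that the rotation vector `ω` is well defined. -/
def HasRotationVector {d : ℕ} (W : UnitAddTorus (Fin d) → ℝ) (c : Fin d → ℝ)
    (u : UnitAddTorus (Fin d) → ℝ) (ω : Fin d → ℝ) : Prop :=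
  ∃ X Y : (Fin d → ℝ) → Fin d → ℝ, ContDiff ℝ 1 X ∧ ContDiff ℝ 1 Y ∧
    Function.LeftInverse Y X ∧ Function.RightInverse Y X ∧
    (∀ θ (k : Fin d → ℤ), X (θ + fun i => (k i : ℝ)) = X θ + fun i => (k i : ℝ)) ∧
    ∀ θ, IsTrajectory W (fun t => X (θ + t • ω)) (fun t => c + grad u (X (θ + t • ω)))

/-! ### Spectrum and resonances -/

/-- The spectrum `S_U` of `U`. -/
def spectrumSet {d : ℕ} (U : UnitAddTorus (Fin d) → ℝ) : Set (Fin d → ℤ) :=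
  {k | UnitAddTorus.mFourierCoeff (fun x => (U x : ℂ)) k ≠ 0}

/-- The coprime integer vectors `b` without vanishing entries which are orthogonal to some
non-zero element of the spectrum of `U`. -/
def resonances {d : ℕ} (U : UnitAddTorus (Fin d) → ℝ) : Set (Fin d → ℤ) :=
  {b | (∃ k ∈ spectrumSet U, k ≠ 0 ∧ ∑ i, b i * k i = 0) ∧
    Finset.univ.gcd b = 1 ∧ ∀ i, b i ≠ 0}

/-- `D` is the `i`-degree of `U`: the least `D ≥ 0` with `|k_i| ≤ D` on the spectrum of `U`. -/
def HasDegree {d : ℕ} (U : UnitAddTorus (Fin d) → ℝ) (i : Fin d) (D : ℕ) : Prop :=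
  IsLeast {D : ℕ | ∀ k ∈ spectrumSet U, |k i| ≤ (D : ℤ)} D

/-! ### Preserved integrability -/

/-- The class `c` carries a `b`-torus of `H_0` in `{H_0 = e}`: `|c_i| > √μ_i 𝔠(V_i)`, and there is
an invariant graph `{(x, c + ∇u_c(x))} ⊆ {H_0 = e}` whose rotation vector is a non-zero multiple
of `b`. -/
def IsResonantTorus {d : ℕ} (V : Fin d → UnitAddCircle → ℝ) (μ : Fin d → ℝ) (e : ℝ)
    (b : Fin d → ℤ) (c : Fin d → ℝ) : Prop :=
  (∀ i, Real.sqrt (μ i) * criticalClass (V i) < |c i|) ∧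
    ∃ u, IsC11 u ∧ SolvesHJ (energyPotential V μ 0 0) c u e ∧
      IsInvariantGraph (energyPotential V μ 0 0) c u ∧
      ∃ r : ℝ, r ≠ 0 ∧ HasRotationVector (energyPotential V μ 0 0) c u (fun i => r * (b i : ℝ))

/-- The torus of class `c` is preserved along the deformations `H_{ε_n}`, as an invariant graph
`{(x, c + ∇u_n(x))}` of `H_{ε_n}` with `u_n` a solution of the Hamilton-Jacobi equation
`H_{ε_n}(x, c + ∇u_n) = α_{ε_n}(c)`, and both `u_n` and `α_{ε_n}(c)` can be expanded to first order
in `ε`. -/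
def IsPreserved {d : ℕ} (V : Fin d → UnitAddCircle → ℝ) (μ : Fin d → ℝ)
    (U : UnitAddTorus (Fin d) → ℝ) (ε : ℕ → ℝ) (c : Fin d → ℝ) : Prop :=
  ∃ u : ℕ → UnitAddTorus (Fin d) → ℝ,
    (∀ n, IsC11 (u n) ∧ IsInvariantGraph (energyPotential V μ U (ε n)) c (u n) ∧
      SolvesHJ (energyPotential V μ U (ε n)) c (u n)
        (matherAlpha (energyPotential V μ U (ε n)) c)) ∧
    (∃ u₀ u₁ : UnitAddTorus (Fin d) → ℝ, IsC11 u₀ ∧ IsC11 u₁ ∧ ∃ K : ℝ, ∀ n,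
      C11NormLE (fun x => u n x - (u₀ x + ε n * u₁ x)) (K * ε n ^ 2)) ∧
    ∃ a₀ a₁ K : ℝ, ∀ n,
      |matherAlpha (energyPotential V μ U (ε n)) c - (a₀ + ε n * a₁)| ≤ K * ε n ^ 2

/-- Preserved integrability at energy `e`, for the parameters `μ ∈ Λ`: for every resonance `b`
there is a null sequence `ε_n ≠ 0` such that for every `μ ∈ Λ` the `b`-torus of `H_0` in
`{H_0 = e}` is preserved under `(H_{ε_n})`. -/
def PreservesIntegrability {d : ℕ} (V : Fin d → UnitAddCircle → ℝ)
    (U : UnitAddTorus (Fin d) → ℝ) (e : ℝ) (Λ : Set (Fin d → ℝ)) : Prop :=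
  ∀ b ∈ resonances U, ∃ ε : ℕ → ℝ, (∀ n, ε n ≠ 0) ∧ Tendsto ε atTop (𝓝 0) ∧
    ∀ μ ∈ Λ, ∃ c, IsResonantTorus V μ e b c ∧ IsPreserved V μ U ε c

/-- `U(x) = U_1(x^1) + … + U_d(x^d)` with `U_i ∈ C²(𝕋)`. -/
def IsSeparable {d : ℕ} (U : UnitAddTorus (Fin d) → ℝ) : Prop :=
  ∃ Us : Fin d → UnitAddCircle → ℝ, (∀ i, ContDiff ℝ 2 (lift₁ (Us i))) ∧
    ∀ x, U x = ∑ i, Us i (x i)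

/-- The indices that are neither flat nor analytic. -/
abbrev MidIndex (d dflat danlyt : ℕ) : Type :=
  {i : Fin d // dflat ≤ (i : ℕ) ∧ (i : ℕ) + danlyt < d}

/-- The last `danlyt` indices. -/
abbrev AnalyticIndex (d danlyt : ℕ) : Type := {i : Fin d // d ≤ (i : ℕ) + danlyt}

end LiouvilleRigidity

/-! Separable dynamics. `H_0` splits into pendulum-like systems `p²/2 - μ_i V_i`. On a `b`-torus
each has its own energy `E_i > 0`, with `∑ E_i = e`, and with `l_i = μ_i / E_i` the normalized
primitive of `(1 + l_i V_i)^{-1/2}` is a coordinate moving linearly in time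
(`exists_energy_of_translation`). If `T` is the time in which the orbits advance by `b`, then `2 E_i
T² = b_i² W_i(l_i)²`, where `W_i` is the total weight of a period. Hence `l_i W_i(l_i)² = 2T² μ_i /
b_i²`, and summing energies gives one monotone equation for `2T²`. So the angle variables depend
only on `e`, `b` and `μ` (`angle_of_isClosedOrbit`).

First-order condition. Expanding the Hamilton-Jacobi equation in `ε` gives `⟨c + ∇u₀, ∇u₁⟩ + U = a₁`
(`IsPreserved.exists_first_order`), and `∇u₀` agrees with the gradient of the given torus
(`grad_eq_of_solvesHJ`). Integrated over the closed orbits, this says that `U` has the same average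
on all of them (`exists_average_eq`). Equivalently, in the angle variables `U` has no Fourier mode
`m ≠ 0` with `m ⬝ b = 0`. In terms of the original coefficients this is `∑_k U_k ∏_i A_i(k_i, m_i) =
0`, where `A_i` is `modeCoeff` (`IsPerturbation.hasSum_prod_modeCoeff`).

Finite linear systems. For every spectral `m` with two non-zero entries, `exists_resonance` supplies
a `b ⟂ m`. In flat variables `A_i` is the Kronecker delta, and `A_i(0, m_i) = 0` for `m_i ≠ 0`; so
with the flat entries fixed only the finitely many `k` in `fiber` contribute. This gives a square
system, one torus per row. If its determinant is non-zero, all these `U_k` vanish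
(`fourierCoeff_eq_zero_of_isPreserved`), the spectrum lies on the axes, and `U` is separable
(`IsPerturbation.isSeparable`).

The determinant. The non-flat entries of `b` can be taken comparable to `|b|`, so small `μ_i` give
small `l_i`, and the matrix is near the identity (`det_resonanceMatrix_ne_zero`). Large parameters
are reached by analyticity: along each ray of analytic parameters the determinant is analytic and
non-zero near the origin, so it vanishes only on a null set of the ray. Polar slicing
(`volume_eq_zero_of_rays`) and a countable union over fibers give `N(s)`. -/

namespace LiouvilleRigidity

/-! ### The angle variable of a one-dimensional mechanical system -/

section Weight

open scoped unitInterval ContDiff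

/-- The weight `(1 + l v(x))^{-1/2}`, where negative `l` are replaced by `0`. -/
noncomputable def weight (v : ℝ → ℝ) (l x : ℝ) : ℝ := (√(1 + max l 0 * v x))⁻¹

/-- The total weight of a period. -/
noncomputable def mass (v : ℝ → ℝ) (l : ℝ) : ℝ := ∫ x in (0 : ℝ)..1, weight v l x

/-- The normalized primitive of the weight: the angle variable of the motion in the potential
`-l v` at energy `1`. -/
noncomputable def angle (v : ℝ → ℝ) (l x : ℝ) : ℝ := (∫ y in (0 : ℝ)..x, weight v l y) / mass v l

/-- The `m`-th Fourier coefficient, with respect to the angle variable, of the `k`-th exponential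
monomial. -/
noncomputable def modeCoeff (v : ℝ → ℝ) (l : ℝ) (k m : ℤ) : ℂ :=
  ∫ x in (0 : ℝ)..1, Complex.exp (2 * Real.pi * Complex.I * (k * x - m * (angle v l x : ℝ))) *
    ((weight v l x / mass v l : ℝ) : ℂ)

variable {v : ℝ → ℝ}

lemma one_le_one_add_max_mul (hv : ∀ x, 0 ≤ v x) (l x : ℝ) : 1 ≤ 1 + max l 0 * v x := by
  have := mul_nonneg (le_max_right l 0) (hv x)
  linarith

lemma weight_pos (hv : ∀ x, 0 ≤ v x) (l x : ℝ) : 0 < weight v l x :=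
  inv_pos.2 (Real.sqrt_pos.2 (by linarith [one_le_one_add_max_mul hv l x]))

lemma weight_le_one (hv : ∀ x, 0 ≤ v x) (l x : ℝ) : weight v l x ≤ 1 :=
  inv_le_one_of_one_le₀ (Real.one_le_sqrt.2 (one_le_one_add_max_mul hv l x))

lemma weight_sq_mul (hv : ∀ x, 0 ≤ v x) {l : ℝ} (hl : 0 ≤ l) (x : ℝ) :
    weight v l x ^ 2 * (1 + l * v x) = 1 := by
  have h := one_le_one_add_max_mul hv l x
  rw [max_eq_left hl] at h
  rw [weight, max_eq_left hl, inv_pow, Real.sq_sqrt (by linarith)]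
  exact inv_mul_cancel₀ (by linarith)

lemma continuous_weight_uncurry (hc : Continuous v) (hv : ∀ x, 0 ≤ v x) :
    Continuous fun z : ℝ × ℝ => weight v z.1 z.2 := by
  unfold weight
  refine Continuous.inv₀ (by fun_prop) fun z => ?_
  exact (Real.sqrt_pos.2 (by linarith [one_le_one_add_max_mul hv z.1 z.2])).ne'

lemma continuous_weight (hc : Continuous v) (hv : ∀ x, 0 ≤ v x) (l : ℝ) :
    Continuous (weight v l) :=
  (continuous_weight_uncurry hc hv).comp (by fun_prop : Continuous fun x : ℝ => (l, x))

lemma mass_pos (hc : Continuous v) (hv : ∀ x, 0 ≤ v x) (l : ℝ) : 0 < mass v l :=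
  intervalIntegral.intervalIntegral_pos_of_pos
    ((continuous_weight hc hv l).intervalIntegrable _ _) (weight_pos hv l) zero_lt_one

lemma mass_le_one (hc : Continuous v) (hv : ∀ x, 0 ≤ v x) (l : ℝ) : mass v l ≤ 1 := by
  have h := intervalIntegral.integral_mono_on (a := 0) (b := 1) (μ := volume) zero_le_one
    ((continuous_weight hc hv l).intervalIntegrable _ _) (intervalIntegrable_const (c := (1 : ℝ)))
    fun x _ => weight_le_one hv l x
  simpa [mass] using h

lemma continuous_primitive_weight (hc : Continuous v) (hv : ∀ x, 0 ≤ v x) :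
    Continuous fun z : ℝ × ℝ => ∫ y in (0 : ℝ)..z.2, weight v z.1 y :=
  intervalIntegral.continuous_parametric_primitive_of_continuous (μ := volume) (a₀ := 0)
    (f := weight v) (continuous_weight_uncurry hc hv)

lemma continuous_mass (hc : Continuous v) (hv : ∀ x, 0 ≤ v x) : Continuous (mass v) :=
  (continuous_primitive_weight hc hv).comp (by fun_prop : Continuous fun l : ℝ => (l, (1 : ℝ)))

lemma continuous_angle_uncurry (hc : Continuous v) (hv : ∀ x, 0 ≤ v x) :
    Continuous fun z : ℝ × ℝ => angle v z.1 z.2 :=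
  (continuous_primitive_weight hc hv).div ((continuous_mass hc hv).comp continuous_fst)
    fun z => (mass_pos hc hv z.1).ne'

lemma continuous_modeCoeff (hc : Continuous v) (hv : ∀ x, 0 ≤ v x) (k m : ℤ) :
    Continuous fun l => modeCoeff v l k m := by
  unfold modeCoeff
  refine intervalIntegral.continuous_parametric_intervalIntegral_of_continuous' (μ := volume)
    (f := fun l x => Complex.exp (2 * Real.pi * Complex.I * (k * x - m * (angle v l x : ℝ))) *
      ((weight v l x / mass v l : ℝ) : ℂ)) ?_ 0 1
  have h1 := continuous_angle_uncurry hc hv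
  have h2 := continuous_weight_uncurry hc hv
  have h3 : Continuous fun z : ℝ × ℝ => mass v z.1 := (continuous_mass hc hv).comp continuous_fst
  have h4 : Continuous fun z : ℝ × ℝ => weight v z.1 z.2 / mass v z.1 :=
    h2.div h3 fun z => (mass_pos hc hv z.1).ne'
  simp only [Function.uncurry_def]
  fun_prop

lemma hasDerivAt_angle (hc : Continuous v) (hv : ∀ x, 0 ≤ v x) (l x : ℝ) :
    HasDerivAt (angle v l) (weight v l x / mass v l) x :=
  (intervalIntegral.integral_hasDerivAt_right ((continuous_weight hc hv l).intervalIntegrable _ _)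
    ((continuous_weight hc hv l).stronglyMeasurableAtFilter _ _)
    (continuous_weight hc hv l).continuousAt).div_const _

/-! ### Analytic dependence on the parameter -/

/-- The weight as a curve in the Banach algebra of continuous functions. -/
noncomputable def weightMap (hc : Continuous v) (hv : ∀ x, 0 ≤ v x) (l : ℝ) : C(I, ℝ) :=
  ⟨fun x => weight v l x, (continuous_weight hc hv l).comp continuous_subtype_val⟩

/-- The weight solves the polynomial equation `w² (1 + l v) = 1` in the Banach algebra `C(I, ℝ)`, so
the analytic implicit function theorem applies. The parameter must be positive because negative
values are clamped to `0`. -/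
lemma analyticAt_weightMap (hc : Continuous v) (hv : ∀ x, 0 ≤ v x) {l₀ : ℝ} (hl : 0 < l₀) :
    AnalyticAt ℝ (weightMap hc hv) l₀ := by
  set vI : C(I, ℝ) := ⟨fun x => v x, hc.comp continuous_subtype_val⟩ with hvI
  set F : ℝ × C(I, ℝ) → C(I, ℝ) := fun z => z.2 * z.2 * (1 + z.1 • vI) with hF
  set x₀ := weightMap hc hv l₀ with hx₀
  have hcd : ContDiff ℝ ω F := by
    have h1 : ContDiff ℝ ω fun z : ℝ × C(I, ℝ) => z.1 • vI := contDiff_fst.smul contDiff_const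
    exact (contDiff_snd.mul contDiff_snd).mul (contDiff_const.add h1)
  have cdf : ContDiffAt ℝ ω F (l₀, x₀) := hcd.contDiffAt
  have hinv : x₀ * x₀ * (1 + l₀ • vI) = 1 := by
    ext x
    have := weight_sq_mul hv hl.le x
    simp only [hx₀, weightMap, hvI, ContinuousMap.mul_apply, ContinuousMap.add_apply,
      ContinuousMap.smul_apply, ContinuousMap.one_apply, ContinuousMap.coe_mk, smul_eq_mul]
    linarith
  have hder : fderiv ℝ F (l₀, x₀) ∘L .inr ℝ ℝ C(I, ℝ) =
      ContinuousLinearMap.mul ℝ C(I, ℝ) ((2 : ℝ) • (x₀ * (1 + l₀ • vI))) := by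
    have h1 : HasFDerivAt (fun y : C(I, ℝ) => F (l₀, y))
        (fderiv ℝ F (l₀, x₀) ∘L .inr ℝ ℝ C(I, ℝ)) x₀ :=
      HasFDerivAt.comp x₀ (g := F)
        ((hcd.differentiable (by simp)) (l₀, x₀)).hasFDerivAt (hasFDerivAt_prodMk_right l₀ x₀)
    have h2 := ((hasFDerivAt_id (𝕜 := ℝ) x₀).mul (hasFDerivAt_id x₀)).mul_const (1 + l₀ • vI)
    refine (h1.unique h2).trans ?_
    ext1 y
    simp only [id, smul_apply, add_apply, ContinuousLinearMap.mul_apply',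
      ContinuousLinearMap.id_apply, smul_eq_mul, two_smul]
    ring
  -- The inverse is multiplication by `x₀ / 2`, since `x₀² (1 + l₀ v) = 1`.
  have hinvert : (fderiv ℝ F (l₀, x₀) ∘L .inr ℝ ℝ C(I, ℝ)).IsInvertible := by
    rw [hder]
    refine ⟨ContinuousLinearEquiv.equivOfInverse
      (ContinuousLinearMap.mul ℝ C(I, ℝ) ((2 : ℝ) • (x₀ * (1 + l₀ • vI))))
      (ContinuousLinearMap.mul ℝ C(I, ℝ) ((2 : ℝ)⁻¹ • x₀)) (fun y => ?_) (fun y => ?_), by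
        ext1; rfl⟩
    · simp only [ContinuousLinearMap.mul_apply', smul_mul_assoc, mul_smul_comm, smul_smul]
      norm_num
      linear_combination y * hinv
    · simp only [ContinuousLinearMap.mul_apply', smul_mul_assoc, mul_smul_comm, smul_smul]
      norm_num
      linear_combination y * hinv
  set ψ := cdf.implicitFunction (by simp) hinvert with hψ
  have hψa : ContDiffAt ℝ ω ψ l₀ := cdf.contDiffAt_implicitFunction (by simp) hinvert
  have hψ0 : ψ l₀ = x₀ := cdf.implicitFunction_apply_self (by simp) hinvert
  have hψe : ∀ᶠ l in 𝓝 l₀, F (l, ψ l) = F (l₀, x₀) :=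
    cdf.eventually_apply_implicitFunction (by simp) hinvert
  -- The implicit function is only known to be some square root. Staying within `min x₀ > 0` of `x₀`
  -- in sup norm keeps it positive, which identifies it with the weight.
  obtain ⟨z, -, hz⟩ := isCompact_univ.exists_isMinOn (Set.univ_nonempty (α := I))
    x₀.continuous.continuousOn
  have hz0 : 0 < x₀ z := weight_pos hv l₀ z
  have hnear : ∀ᶠ l in 𝓝 l₀, dist (ψ l) x₀ < x₀ z := by
    have := hψa.continuousAt.tendsto
    rw [hψ0] at this
    exact (Metric.tendsto_nhds.1 this) _ hz0
  refine hψa.analyticAt.congr ?_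
  filter_upwards [hψe, hnear, lt_mem_nhds hl] with l h1 h2 h3
  ext x
  have h4 : 0 < ψ l x := by
    have h5 := (ContinuousMap.dist_apply_le_dist x).trans_lt h2
    rw [Real.dist_eq, abs_lt] at h5
    have h6 : x₀ z ≤ x₀ x := hz (Set.mem_univ x)
    linarith
  have h5 : ψ l x * ψ l x * (1 + l * v x) = 1 := by
    have := congrArg (fun f : C(I, ℝ) => f x) (h1.trans hinv)
    simpa [hF, hvI] using this
  have h6 := weight_sq_mul hv h3.le x
  have h7 := one_le_one_add_max_mul hv l x
  rw [max_eq_left h3.le] at h7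
  have h8 : ψ l x ^ 2 = weight v l x ^ 2 :=
    mul_right_cancel₀ (b := 1 + l * v x) (by linarith) (by linarith)
  exact (pow_left_inj₀ h4.le (weight_pos hv l x).le two_ne_zero).1 h8

/-- The integral over the unit interval as a continuous linear functional. -/
noncomputable def unitIntegral (E : Type*) [NormedAddCommGroup E] [NormedSpace ℝ E] :
    C(I, E) →L[ℝ] E :=
  LinearMap.mkContinuous
    { toFun := fun f => ∫ x in (0 : ℝ)..1, f (Set.projIcc 0 1 zero_le_one x)
      map_add' := fun f g => by
        simp only [ContinuousMap.add_apply]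
        refine intervalIntegral.integral_add ?_ ?_ <;>
        exact (ContinuousMap.continuous _ |>.comp continuous_projIcc).intervalIntegrable _ _
      map_smul' := fun c f => by simp }
    1 fun f => by
      have := intervalIntegral.norm_integral_le_of_norm_le_const (a := (0 : ℝ)) (b := 1)
        (f := fun x => f (Set.projIcc 0 1 zero_le_one x)) (C := ‖f‖)
        fun x _ => f.norm_coe_le_norm _
      simpa using this

lemma unitIntegral_eq {E : Type*} [NormedAddCommGroup E] [NormedSpace ℝ E] (f : C(I, E))
    (g : ℝ → E) (h : ∀ x : I, f x = g x) : unitIntegral E f = ∫ x in (0 : ℝ)..1, g x := by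
  refine intervalIntegral.integral_congr fun x hx => ?_
  rw [Set.uIcc_of_le zero_le_one] at hx
  simp only [h, Set.projIcc_of_mem zero_le_one hx]

/-- The primitive vanishing at `0`, as a continuous linear operator. -/
noncomputable def unitPrimitive : C(I, ℝ) →L[ℝ] C(I, ℝ) :=
  LinearMap.mkContinuous
    { toFun := fun f => ⟨fun t => ∫ x in (0 : ℝ)..t, f (Set.projIcc 0 1 zero_le_one x), by
        exact (intervalIntegral.continuous_primitive (μ := volume) (fun a b =>
          (f.continuous.comp continuous_projIcc).intervalIntegrable a b) 0).comp
          continuous_subtype_val⟩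
      map_add' := fun f g => by
        ext t
        simp only [ContinuousMap.add_apply, ContinuousMap.coe_mk]
        refine intervalIntegral.integral_add ?_ ?_ <;>
        exact (ContinuousMap.continuous _ |>.comp continuous_projIcc).intervalIntegrable _ _
      map_smul' := fun c f => by ext; simp }
    1 fun f => by
      refine (ContinuousMap.norm_le _ (by positivity)).2 fun t => ?_
      have := intervalIntegral.norm_integral_le_of_norm_le_const (a := (0 : ℝ)) (b := t)
        (f := fun x => f (Set.projIcc 0 1 zero_le_one x)) (C := ‖f‖)
        fun x _ => f.norm_coe_le_norm _
      refine this.trans ?_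
      rw [sub_zero, abs_of_nonneg t.2.1, mul_comm]
      exact mul_le_mul_of_nonneg_right t.2.2 (norm_nonneg f)

lemma unitPrimitive_apply (f : C(I, ℝ)) (g : ℝ → ℝ) (h : ∀ x : I, f x = g x) (t : I) :
    unitPrimitive f t = ∫ x in (0 : ℝ)..t, g x := by
  refine intervalIntegral.integral_congr fun x hx => ?_
  rw [Set.uIcc_of_le t.2.1] at hx
  simp only [h, Set.projIcc_of_mem zero_le_one (Set.Icc_subset_Icc_right t.2.2 hx)]

lemma mass_eq_unitIntegral (hc : Continuous v) (hv : ∀ x, 0 ≤ v x) (l : ℝ) :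
    mass v l = unitIntegral ℝ (weightMap hc hv l) :=
  (unitIntegral_eq (weightMap hc hv l) (weight v l) fun _ => rfl).symm

lemma analyticAt_mass (hc : Continuous v) (hv : ∀ x, 0 ≤ v x) {l₀ : ℝ} (hl : 0 < l₀) :
    AnalyticAt ℝ (mass v) l₀ := by
  rw [show mass v = fun l => unitIntegral ℝ (weightMap hc hv l) from
    funext (mass_eq_unitIntegral hc hv)]
  exact ((unitIntegral ℝ).analyticAt _).comp (analyticAt_weightMap hc hv hl)

lemma analyticAt_modeCoeff (hc : Continuous v) (hv : ∀ x, 0 ≤ v x) (k m : ℤ) {l₀ : ℝ}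
    (hl : 0 < l₀) : AnalyticAt ℝ (fun l => modeCoeff v l k m) l₀ := by
  set toC : C(I, ℝ) →L[ℝ] C(I, ℂ) := Complex.ofRealCLM.compLeftContinuous ℝ I with htoC
  set e₀ : C(I, ℂ) := ⟨fun x => 2 * Real.pi * Complex.I * (k * ((x : ℝ) : ℂ)), by fun_prop⟩
    with he₀
  set c₀ : C(I, ℂ) := ContinuousMap.const I (2 * Real.pi * Complex.I * m) with hc₀
  -- The whole integrand as a curve in `C(I, ℂ)`, built from the weight by bounded linear maps,
  -- products and the analytic exponential of the algebra.
  set G : ℝ → C(I, ℂ) := fun l =>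
    NormedSpace.exp (e₀ - c₀ * toC ((mass v l)⁻¹ • unitPrimitive (weightMap hc hv l))) *
      toC ((mass v l)⁻¹ • weightMap hc hv l) with hG
  have hm := (analyticAt_mass hc hv hl).inv (mass_pos hc hv l₀).ne'
  have hw := analyticAt_weightMap hc hv hl
  have hGa : AnalyticAt ℝ G l₀ := by
    have h1 : AnalyticAt ℝ (fun l => toC ((mass v l)⁻¹ • weightMap hc hv l)) l₀ :=
      (toC.analyticAt _).comp (hm.smul hw)
    have h2 : AnalyticAt ℝ
        (fun l => toC ((mass v l)⁻¹ • unitPrimitive (weightMap hc hv l))) l₀ :=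
      (toC.analyticAt _).comp (hm.smul ((unitPrimitive.analyticAt _).comp hw))
    refine AnalyticAt.mul ?_ h1
    exact (NormedSpace.exp_analytic (𝕂 := ℝ) _).comp
      (analyticAt_const.sub (analyticAt_const.mul h2))
  have hexp : ∀ (f : C(I, ℂ)) (x : I), (NormedSpace.exp f) x = Complex.exp (f x) := by
    intro f x
    rw [Complex.exp_eq_exp_ℂ]
    exact NormedSpace.map_exp (ContinuousMap.evalAlgHom ℂ ℂ x) (continuous_eval_const x) f
  have hGe : (fun l => modeCoeff v l k m) = fun l => unitIntegral ℂ (G l) := by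
    funext l
    refine (unitIntegral_eq _ _ fun x => ?_).symm
    have hp := unitPrimitive_apply (weightMap hc hv l) (weight v l) (fun _ => rfl) x
    simp only [hG, ContinuousMap.mul_apply, hexp, ContinuousMap.sub_apply]
    have t1 : ∀ f : C(I, ℝ), toC f x = ((f x : ℝ) : ℂ) := fun f => rfl
    simp only [t1, ContinuousMap.smul_apply, hp, smul_eq_mul, he₀, hc₀, ContinuousMap.const_apply,
      ContinuousMap.coe_mk, angle]
    congr 2
    · rw [div_eq_inv_mul]; ring
    · rw [div_eq_inv_mul]; rfl
  rw [hGe]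
  exact ((unitIntegral ℂ).analyticAt _).comp hGa

end Weight

/-! ### The angle variable as a circle diffeomorphism, and bounds on its mode coefficients -/

section Angle

variable {v : ℝ → ℝ}

lemma angle_zero (v : ℝ → ℝ) (l : ℝ) : angle v l 0 = 0 := by simp [angle]

lemma angle_one (hc : Continuous v) (hv : ∀ x, 0 ≤ v x) (l : ℝ) : angle v l 1 = 1 :=
  div_self (mass_pos hc hv l).ne'

lemma angle_add_one (hc : Continuous v) (hv : ∀ x, 0 ≤ v x) (hp : Function.Periodic v 1)
    (l x : ℝ) : angle v l (x + 1) = angle v l x + 1 := by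
  have hw : Function.Periodic (weight v l) 1 := fun y => by simp only [weight, hp y]
  have hi : ∀ a b, IntervalIntegrable (weight v l) volume a b :=
    fun a b => (continuous_weight hc hv l).intervalIntegrable a b
  have h1 := hw.intervalIntegral_add_eq x 0
  rw [zero_add] at h1
  rw [angle, ← intervalIntegral.integral_add_adjacent_intervals (hi 0 x) (hi x (x + 1)), h1,
    add_div, ← mass, div_self (mass_pos hc hv l).ne', angle]

lemma angle_add_int (hc : Continuous v) (hv : ∀ x, 0 ≤ v x) (hp : Function.Periodic v 1)
    (l x : ℝ) (n : ℤ) : angle v l (x + n) = angle v l x + n := by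
  have h : Function.Periodic (fun y => angle v l y - y) 1 := fun y => by
    simp only [angle_add_one hc hv hp]; ring
  have := h.int_mul n x
  simp only [mul_one] at this
  linarith

lemma strictMono_angle (hc : Continuous v) (hv : ∀ x, 0 ≤ v x) (l : ℝ) :
    StrictMono (angle v l) :=
  strictMono_of_hasDerivAt_pos (hasDerivAt_angle hc hv l)
    fun x => div_pos (weight_pos hv l x) (mass_pos hc hv l)

lemma continuous_angle (hc : Continuous v) (hv : ∀ x, 0 ≤ v x) (l : ℝ) :
    Continuous (angle v l) :=
  continuous_iff_continuousAt.2 fun x => (hasDerivAt_angle hc hv l x).continuousAt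

lemma surjective_angle (hc : Continuous v) (hv : ∀ x, 0 ≤ v x) (hp : Function.Periodic v 1)
    (l : ℝ) : Function.Surjective (angle v l) := by
  intro y
  have h : ∀ n : ℤ, angle v l n = n := fun n => by
    have := angle_add_int hc hv hp l 0 n
    rwa [zero_add, angle_zero, zero_add] at this
  have h1 : angle v l (⌊y⌋ : ℤ) ≤ y := by rw [h]; exact Int.floor_le y
  have h2 : y ≤ angle v l ((⌊y⌋ + 1 : ℤ) : ℝ) := by
    rw [h]; push_cast; exact (Int.lt_floor_add_one y).le
  exact mem_range_of_exists_le_of_exists_ge (continuous_angle hc hv l) ⟨_, h1⟩ ⟨_, h2⟩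

/-- The angle variable as an order isomorphism of the line. -/
noncomputable def angleIso (hc : Continuous v) (hv : ∀ x, 0 ≤ v x) (hp : Function.Periodic v 1)
    (l : ℝ) : ℝ ≃o ℝ :=
  StrictMono.orderIsoOfSurjective _ (strictMono_angle hc hv l) (surjective_angle hc hv hp l)

lemma angleIso_apply (hc : Continuous v) (hv : ∀ x, 0 ≤ v x) (hp : Function.Periodic v 1)
    (l x : ℝ) : angleIso hc hv hp l x = angle v l x := rfl

lemma angleIso_symm_add_one (hc : Continuous v) (hv : ∀ x, 0 ≤ v x) (hp : Function.Periodic v 1)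
    (l x : ℝ) : (angleIso hc hv hp l).symm (x + 1) = (angleIso hc hv hp l).symm x + 1 := by
  rw [OrderIso.symm_apply_eq, angleIso_apply, angle_add_one hc hv hp, ← angleIso_apply hc hv hp,
    OrderIso.apply_symm_apply]

lemma integral_comp_angle_mul (hc : Continuous v) (hv : ∀ x, 0 ≤ v x) (l : ℝ) {g : ℝ → ℂ}
    (hg : Continuous g) :
    ∫ x in (0 : ℝ)..1, g (angle v l x) * ((weight v l x / mass v l : ℝ) : ℂ) =
      ∫ y in (0 : ℝ)..1, g y := by
  have h := intervalIntegral.integral_deriv_smul_comp (a := 0) (b := 1) (f := angle v l)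
    (f' := fun x => weight v l x / mass v l) (g := g)
    (fun x _ => hasDerivAt_angle hc hv l x)
    ((continuous_weight hc hv l).div_const _).continuousOn hg
  rw [angle_zero, angle_one hc hv] at h
  rw [← h]
  refine intervalIntegral.integral_congr fun x _ => ?_
  simp [mul_comm]

lemma modeCoeff_eq_integral_symm (hc : Continuous v) (hv : ∀ x, 0 ≤ v x)
    (hp : Function.Periodic v 1) (l : ℝ) (k m : ℤ) :
    modeCoeff v l k m = ∫ y in (0 : ℝ)..1, Complex.exp (2 * Real.pi * Complex.I *
      (k * ((angleIso hc hv hp l).symm y : ℝ) - m * y)) := by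
  have hs : Continuous (angleIso hc hv hp l).symm := (angleIso hc hv hp l).symm.continuous
  rw [← integral_comp_angle_mul hc hv l (by fun_prop)]
  refine intervalIntegral.integral_congr fun x _ => ?_
  simp only [← angleIso_apply hc hv hp, OrderIso.symm_apply_apply]

lemma integral_exp_two_pi_int (n : ℤ) :
    ∫ y in (0 : ℝ)..1, Complex.exp (2 * Real.pi * Complex.I * (n * y)) = if n = 0 then 1 else 0 := by
  split_ifs with h
  · simp [h]
  · have hne : (2 * Real.pi * Complex.I * n : ℂ) ≠ 0 := by
      simp [Real.pi_ne_zero, Complex.I_ne_zero, h]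
    have := integral_exp_mul_complex (a := 0) (b := 1) hne
    simp only [← mul_assoc]
    rw [this]
    have h1 : Complex.exp (2 * Real.pi * Complex.I * n) = 1 := by
      rw [mul_comm]; exact Complex.exp_int_mul_two_pi_mul_I n
    simp [h1]

/-- A constant stays constant under a change of variable. This confines the linear systems to modes
that are non-zero wherever `m` is non-zero at two chosen places. -/
lemma modeCoeff_zero_left (hc : Continuous v) (hv : ∀ x, 0 ≤ v x) (l : ℝ) (m : ℤ) :
    modeCoeff v l 0 m = if m = 0 then 1 else 0 := by
  have h := integral_comp_angle_mul hc hv l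
    (g := fun y => Complex.exp (2 * Real.pi * Complex.I * (((-m : ℤ) : ℂ) * y))) (by fun_prop)
  rw [integral_exp_two_pi_int] at h
  simp only [neg_eq_zero] at h
  rw [← h, modeCoeff]
  refine intervalIntegral.integral_congr fun x _ => ?_
  simp

lemma weight_of_nonpos (v : ℝ → ℝ) {l : ℝ} (hl : l ≤ 0) (x : ℝ) : weight v l x = 1 := by
  simp [weight, max_eq_right hl]

lemma mass_of_nonpos (v : ℝ → ℝ) {l : ℝ} (hl : l ≤ 0) : mass v l = 1 := by
  simp [mass, weight_of_nonpos v hl]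

/-- Without a potential the angle is the original coordinate; this is the case of the flat
variables. -/
lemma modeCoeff_of_nonpos (v : ℝ → ℝ) {l : ℝ} (hl : l ≤ 0) (k m : ℤ) :
    modeCoeff v l k m = if k = m then 1 else 0 := by
  have h := integral_exp_two_pi_int (k - m)
  simp only [sub_eq_zero] at h
  rw [← h, modeCoeff]
  refine intervalIntegral.integral_congr fun x _ => ?_
  simp [angle, weight_of_nonpos v hl, mass_of_nonpos v hl, sub_mul]

lemma norm_modeCoeff_le_one (hc : Continuous v) (hv : ∀ x, 0 ≤ v x)
    (hp : Function.Periodic v 1) (l : ℝ) (k m : ℤ) : ‖modeCoeff v l k m‖ ≤ 1 := by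
  rw [modeCoeff_eq_integral_symm hc hv hp]
  have := intervalIntegral.norm_integral_le_of_norm_le_const (a := (0 : ℝ)) (b := 1) (C := 1)
    (f := fun y : ℝ => Complex.exp (2 * Real.pi * Complex.I *
      (k * ((angleIso hc hv hp l).symm y : ℝ) - m * y))) fun y _ => by
    rw [show (2 * Real.pi * Complex.I * (k * ((angleIso hc hv hp l).symm y : ℝ) - m * y) : ℂ) =
      ((2 * Real.pi * (k * (angleIso hc hv hp l).symm y - m * y) : ℝ) : ℂ) * Complex.I by
        push_cast; ring, Complex.norm_exp_ofReal_mul_I]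
  simpa using this

lemma inv_sqrt_le_weight (hv : ∀ x, 0 ≤ v x) {l C : ℝ} (hl : 0 ≤ l) (hC : ∀ x, v x ≤ C) (x : ℝ) :
    (√(1 + l * C))⁻¹ ≤ weight v l x := by
  rw [weight, max_eq_left hl]
  have h1 := one_le_one_add_max_mul hv l x
  rw [max_eq_left hl] at h1
  exact inv_anti₀ (Real.sqrt_pos.2 (by linarith))
    (Real.sqrt_le_sqrt (by linarith [mul_le_mul_of_nonneg_left (hC x) hl]))

lemma inv_sqrt_le_mass (hc : Continuous v) (hv : ∀ x, 0 ≤ v x) {l C : ℝ} (hl : 0 ≤ l)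
    (hC : ∀ x, v x ≤ C) : (√(1 + l * C))⁻¹ ≤ mass v l := by
  have h := intervalIntegral.integral_mono_on (a := 0) (b := 1) (μ := volume) zero_le_one
    (intervalIntegrable_const (c := (√(1 + l * C))⁻¹))
    ((continuous_weight hc hv l).intervalIntegrable _ _)
    fun x _ => inv_sqrt_le_weight hv hl hC x
  simpa [mass] using h

/-- With `q = √(1 + l C)`, weight and mass both lie in `[1/q, 1]`, so their quotient lies in `[1/q,
q]`, and `q ≤ 1 + l C`. -/
lemma abs_weight_div_mass_sub_one_le (hc : Continuous v) (hv : ∀ x, 0 ≤ v x) {l C : ℝ}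
    (hl : 0 ≤ l) (hC : ∀ x, v x ≤ C) (x : ℝ) : |weight v l x / mass v l - 1| ≤ l * C := by
  have hw := inv_sqrt_le_weight hv hl hC
  have hm := inv_sqrt_le_mass hc hv hl hC
  set q := √(1 + l * C) with hq
  have hlC : 0 ≤ l * C := mul_nonneg hl ((hv 0).trans (hC 0))
  have hq1 : 1 ≤ q := Real.one_le_sqrt.2 (by linarith)
  have hqC : q ≤ 1 + l * C := Real.sqrt_le_iff.2 ⟨by linarith, by nlinarith⟩
  have hmp := mass_pos hc hv l
  have hq0 : 0 < q := by linarith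
  have hup : weight v l x / mass v l ≤ q := by
    rw [div_le_iff₀ hmp]
    calc weight v l x ≤ 1 := weight_le_one hv l x
      _ = q * q⁻¹ := (mul_inv_cancel₀ hq0.ne').symm
      _ ≤ q * mass v l := by gcongr
  have hlo : q⁻¹ ≤ weight v l x / mass v l := by
    rw [le_div_iff₀ hmp]
    calc q⁻¹ * mass v l ≤ q⁻¹ * 1 := by gcongr; exact mass_le_one hc hv l
      _ ≤ weight v l x := by rw [mul_one]; exact hw x
  have hqi : 1 - q⁻¹ ≤ q - 1 := by
    have : q * q⁻¹ = 1 := mul_inv_cancel₀ hq0.ne'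
    nlinarith [sq_nonneg (q - 1), inv_pos.2 hq0]
  rw [abs_le]
  constructor <;> linarith

lemma abs_angle_sub_le (hc : Continuous v) (hv : ∀ x, 0 ≤ v x) {l C : ℝ}
    (hl : 0 ≤ l) (hC : ∀ x, v x ≤ C) {x : ℝ} (hx : x ∈ Set.Icc (0 : ℝ) 1) :
    |angle v l x - x| ≤ l * C := by
  have h : angle v l x - x = ∫ y in (0 : ℝ)..x, (weight v l y / mass v l - 1) := by
    rw [intervalIntegral.integral_sub (((continuous_weight hc hv l).div_const _).intervalIntegrable
      _ _) intervalIntegrable_const, intervalIntegral.integral_div, angle]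
    simp
  have h2 := intervalIntegral.norm_integral_le_of_norm_le_const (a := (0 : ℝ)) (b := x)
    (C := l * C) (f := fun y => weight v l y / mass v l - 1)
    fun y _ => abs_weight_div_mass_sub_one_le hc hv hl hC y
  rw [h]
  refine h2.trans ?_
  rw [sub_zero, abs_of_nonneg hx.1]
  exact mul_le_of_le_one_right (mul_nonneg hl ((hv 0).trans (hC 0))) hx.2

lemma norm_exp_I_sub_exp_I_le (a b : ℝ) :
    ‖Complex.exp (Complex.I * a) - Complex.exp (Complex.I * b)‖ ≤ |a - b| := by
  have h : Complex.exp (Complex.I * a) - Complex.exp (Complex.I * b) =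
      Complex.exp (b * Complex.I) * (Complex.exp (Complex.I * ((a - b : ℝ) : ℂ)) - 1) := by
    rw [mul_sub, ← Complex.exp_add, mul_one, mul_comm Complex.I (b : ℂ)]
    congr 2
    push_cast; ring
  rw [h, norm_mul, Complex.norm_exp_ofReal_mul_I, one_mul]
  exact Real.norm_exp_I_mul_ofReal_sub_one_le

/-- The density and the angle each differ from their unperturbed values `1` and `x` by at most `l
C`; the latter error enters through the phase, with factor `2π|m|`. -/
lemma norm_modeCoeff_sub_le (hc : Continuous v) (hv : ∀ x, 0 ≤ v x) {l C : ℝ}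
    (hl : 0 ≤ l) (hC : ∀ x, v x ≤ C) (k m : ℤ) :
    ‖modeCoeff v l k m - if k = m then 1 else 0‖ ≤ (1 + 2 * Real.pi * |(m : ℝ)|) * (l * C) := by
  have hlC : 0 ≤ l * C := mul_nonneg hl ((hv 0).trans (hC 0))
  have h0 := integral_exp_two_pi_int (k - m)
  simp only [sub_eq_zero] at h0
  have hca := continuous_angle hc hv l
  have hcw := continuous_weight hc hv l
  rw [← h0, modeCoeff, ← intervalIntegral.integral_sub
    (Continuous.intervalIntegrable (by fun_prop) _ _)
    (Continuous.intervalIntegrable (by fun_prop) _ _)]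
  have key := intervalIntegral.norm_integral_le_of_norm_le_const (a := (0 : ℝ)) (b := 1)
    (C := (1 + 2 * Real.pi * |(m : ℝ)|) * (l * C))
    (f := fun x => Complex.exp (2 * Real.pi * Complex.I * (k * x - m * (angle v l x : ℝ))) *
      ((weight v l x / mass v l : ℝ) : ℂ) -
      Complex.exp (2 * Real.pi * Complex.I * (((k - m : ℤ) : ℂ) * x))) fun x hx => by
    rw [Set.uIoc_of_le zero_le_one] at hx
    set a : ℝ := 2 * Real.pi * (k * x - m * angle v l x) with ha
    set b : ℝ := 2 * Real.pi * (k * x - m * x) with hb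
    have e1 : (2 * Real.pi * Complex.I * (k * x - m * (angle v l x : ℝ)) : ℂ) =
        Complex.I * (a : ℂ) := by rw [ha]; push_cast; ring
    have e2 : (2 * Real.pi * Complex.I * (((k - m : ℤ) : ℂ) * x) : ℂ) =
        Complex.I * (b : ℂ) := by rw [hb]; push_cast; ring
    rw [e1, e2]
    have split : Complex.exp (Complex.I * (a : ℂ)) * ((weight v l x / mass v l : ℝ) : ℂ) -
        Complex.exp (Complex.I * (b : ℂ)) =
        Complex.exp ((a : ℂ) * Complex.I) * ((weight v l x / mass v l - 1 : ℝ) : ℂ) +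
        (Complex.exp (Complex.I * (a : ℂ)) - Complex.exp (Complex.I * (b : ℂ))) := by
      rw [mul_comm (a : ℂ) Complex.I]; push_cast; ring
    rw [split]
    have h1 : ‖Complex.exp ((a : ℂ) * Complex.I) * ((weight v l x / mass v l - 1 : ℝ) : ℂ)‖
        ≤ l * C := by
      rw [norm_mul, Complex.norm_exp_ofReal_mul_I, one_mul, Complex.norm_real]
      exact abs_weight_div_mass_sub_one_le hc hv hl hC x
    have h2 : ‖Complex.exp (Complex.I * (a : ℂ)) - Complex.exp (Complex.I * (b : ℂ))‖
        ≤ 2 * Real.pi * |(m : ℝ)| * (l * C) := by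
      refine (norm_exp_I_sub_exp_I_le a b).trans ?_
      rw [show a - b = -(2 * Real.pi * m * (angle v l x - x)) by rw [ha, hb]; ring, abs_neg,
        abs_mul, abs_mul, abs_of_pos Real.two_pi_pos]
      gcongr
      exact abs_angle_sub_le hc hv hl hC ⟨hx.1.le, hx.2⟩
    calc _ ≤ _ := norm_add_le _ _
      _ ≤ l * C + 2 * Real.pi * |(m : ℝ)| * (l * C) := add_le_add h1 h2
      _ = _ := by ring
  simpa using key

end Angle

/-! ### The relation between strength of the potential and frequency -/

section Profile

open scoped unitInterval

/-- The periodic lifts of the potentials: `C²`, `1`-periodic, non-negative, with a zero. -/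
structure IsProfile (v : ℝ → ℝ) : Prop where
  contDiff : ContDiff ℝ 2 v
  periodic : Function.Periodic v 1
  nonneg : ∀ x, 0 ≤ v x
  exists_zero : ∃ x, v x = 0

lemma IsPotential.isProfile {V : UnitAddCircle → ℝ} {C : ℝ} (h : IsPotential V C) :
    IsProfile (lift₁ V) where
  contDiff := h.contDiff
  periodic x := by simp [lift₁]
  nonneg x := h.nonneg _
  exists_zero := by
    obtain ⟨x, hx⟩ := h.min_eq_zero
    obtain ⟨y, rfl⟩ := QuotientAddGroup.mk_surjective x
    exact ⟨y, hx⟩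

variable {v : ℝ → ℝ}

namespace IsProfile

lemma continuous (h : IsProfile v) : Continuous v := h.contDiff.continuous

lemma hasDerivAt (h : IsProfile v) (x : ℝ) : HasDerivAt v (deriv v x) x :=
  (h.contDiff.differentiable (by simp) x).hasDerivAt

lemma exists_lipschitz_deriv (h : IsProfile v) :
    ∃ K : ℝ, 1 ≤ K ∧ ∀ x y, |deriv v x - deriv v y| ≤ K * |x - y| := by
  have h1 : ContDiff ℝ 1 (deriv v) := by
    have := h.contDiff
    rw [show (2 : WithTop ℕ∞) = 1 + 1 by norm_num, contDiff_succ_iff_deriv] at this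
    exact this.2.2
  have h2 : Continuous (deriv (deriv v)) := h1.continuous_deriv le_rfl
  have hp1 : Function.Periodic (deriv v) 1 := fun x => by
    rw [← deriv_comp_add_const]
    exact congrArg (fun f => deriv f x) (funext h.periodic)
  have hp2 : Function.Periodic (deriv (deriv v)) 1 := fun x => by
    rw [← deriv_comp_add_const]
    exact congrArg (fun f => deriv f x) (funext hp1)
  obtain ⟨C, hC⟩ := isCompact_Icc.exists_bound_of_continuousOn (s := Set.Icc (0 : ℝ) 1)
    h2.continuousOn
  refine ⟨max C 1, le_max_right _ _, fun x y => ?_⟩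
  have hb : ∀ z, ‖deriv (deriv v) z‖ ≤ max C 1 := fun z => by
    obtain ⟨y, hy, hzy⟩ := hp2.exists_mem_Ico₀ one_pos z
    rw [hzy]
    exact (hC y ⟨hy.1, hy.2.le⟩).trans (le_max_left _ _)
  exact Convex.norm_image_sub_le_of_norm_deriv_le (s := Set.univ)
    (fun z _ => (h1.differentiable (by simp)) z) (fun z _ => hb z) convex_univ
    (Set.mem_univ y) (Set.mem_univ x)

lemma deriv_eq_zero (h : IsProfile v) {x : ℝ} (hx : v x = 0) : deriv v x = 0 :=
  IsLocalMin.deriv_eq_zero (Eventually.of_forall fun y => by rw [hx]; exact h.nonneg y)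

/-- A zero of `v` is a minimum, so `v'` vanishes there and its Lipschitz bound gives quadratic
growth. -/
lemma le_mul_sq {K : ℝ} (h : IsProfile v) (hK : ∀ x y, |deriv v x - deriv v y| ≤ K * |x - y|)
    (hK0 : 0 ≤ K) {x : ℝ} (hx : v x = 0) (y : ℝ) : v (x + y) ≤ K * y ^ 2 := by
  have h1 := Convex.norm_image_sub_le_of_norm_deriv_le (s := Set.uIcc x (x + y)) (f := v)
    (C := K * |y|) (x := x) (y := x + y)
    (fun z _ => (h.hasDerivAt z).differentiableAt) (fun z hz => by
      have h2 := hK z x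
      rw [h.deriv_eq_zero hx, sub_zero] at h2
      refine h2.trans (mul_le_mul_of_nonneg_left ?_ hK0)
      have := Set.abs_sub_left_of_mem_uIcc hz
      rwa [add_sub_cancel_left] at this) (convex_uIcc _ _) Set.left_mem_uIcc Set.right_mem_uIcc
  rw [hx, sub_zero, add_sub_cancel_left, Real.norm_of_nonneg (h.nonneg _), Real.norm_eq_abs,
    mul_assoc, abs_mul_abs_self, ← sq] at h1
  exact h1

end IsProfile

/-- The quantity `l W(l)²`, where `W` is the total weight of a period: proportional to the ratio of
the strength of the potential and the square of the frequency. -/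
noncomputable def freqRatio (v : ℝ → ℝ) (l : ℝ) : ℝ := l * mass v l ^ 2

lemma antitone_mass (hc : Continuous v) (hv : ∀ x, 0 ≤ v x) : Antitone (mass v) := by
  intro l l' hl
  refine intervalIntegral.integral_mono_on zero_le_one
    ((continuous_weight hc hv l').intervalIntegrable _ _)
    ((continuous_weight hc hv l).intervalIntegrable _ _) fun x _ => ?_
  refine inv_anti₀ (Real.sqrt_pos.2 (by linarith [one_le_one_add_max_mul hv l x])) ?_
  have := hv x
  gcongr

/-- Differentiating `w² (1 + l v) = 1` gives `w' = -w³ v / 2`, hence `w + 2 l w' = w³`. The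
derivative of `l W²` is therefore `W ∫ w³ > 0`. -/
lemma exists_hasDerivAt_freqRatio (hc : Continuous v) (hv : ∀ x, 0 ≤ v x) {l : ℝ} (hl : 0 < l) :
    ∃ D, 0 < D ∧ HasDerivAt (freqRatio v) D l := by
  have hw : HasDerivAt (weightMap hc hv) (deriv (weightMap hc hv) l) l :=
    (analyticAt_weightMap hc hv hl).differentiableAt.hasDerivAt
  set w' := deriv (weightMap hc hv) l
  set w := weightMap hc hv l with hwdef
  set vI : C(I, ℝ) := ⟨fun x => v x, hc.comp continuous_subtype_val⟩ with hvI
  have hid : ∀ s, 0 ≤ s → weightMap hc hv s * weightMap hc hv s * (1 + s • vI) = 1 := by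
    intro s hs
    ext x
    have := weight_sq_mul hv hs x
    simp only [weightMap, hvI, ContinuousMap.mul_apply, ContinuousMap.add_apply,
      ContinuousMap.smul_apply, ContinuousMap.one_apply, ContinuousMap.coe_mk, smul_eq_mul]
    linarith
  have h1 : HasDerivAt (fun s : ℝ => 1 + s • vI) ((1 : ℝ) • vI) l :=
    ((hasDerivAt_id l).smul_const vI).const_add 1
  have h2 := (hw.mul hw).mul h1
  have h3 : HasDerivAt (fun s => weightMap hc hv s * weightMap hc hv s * (1 + s • vI)) 0 l := by
    refine (hasDerivAt_const l (1 : C(I, ℝ))).congr_of_eventuallyEq ?_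
    filter_upwards [lt_mem_nhds hl] with s hs using hid s hs.le
  have h4 := h2.unique h3
  have hw' : w' = -((1 / 2 : ℝ) • (w * w * w * vI)) := by
    ext x
    have e1 := congrArg (fun f : C(I, ℝ) => f x) h4
    have e2 := congrArg (fun f : C(I, ℝ) => f x) (hid l hl.le)
    simp only [Pi.mul_apply, ContinuousMap.mul_apply, ContinuousMap.add_apply,
      ContinuousMap.smul_apply, ContinuousMap.one_apply, ContinuousMap.zero_apply, smul_eq_mul,
      one_mul, ← hwdef, ContinuousMap.neg_apply] at e1 e2 ⊢
    linear_combination (w x / 2) * e1 - w' x * e2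
  have hm : HasDerivAt (mass v) (unitIntegral ℝ w') l := by
    rw [show mass v = fun l => unitIntegral ℝ (weightMap hc hv l) from
      funext (mass_eq_unitIntegral hc hv)]
    exact (unitIntegral ℝ).hasFDerivAt.comp_hasDerivAt l hw
  have hmass : mass v l = unitIntegral ℝ w := mass_eq_unitIntegral hc hv l
  have hcube : mass v l + 2 * l * unitIntegral ℝ w' = unitIntegral ℝ (w * w * w) := by
    rw [hmass, ← smul_eq_mul (2 * l), ← map_smul, ← map_add]
    congr 1
    ext x
    have e2 := congrArg (fun f : C(I, ℝ) => f x) (hid l hl.le)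
    simp only [hw', ContinuousMap.mul_apply, ContinuousMap.add_apply, ContinuousMap.smul_apply,
      ContinuousMap.one_apply, smul_eq_mul, ContinuousMap.neg_apply, ← hwdef] at e2 ⊢
    linear_combination -(w x) * e2
  have hpos : 0 < unitIntegral ℝ (w * w * w) := by
    rw [unitIntegral_eq _ (fun x => weight v l x * weight v l x * weight v l x) fun _ => rfl]
    have hcw := continuous_weight hc hv l
    refine intervalIntegral.intervalIntegral_pos_of_pos
      (Continuous.intervalIntegrable (by fun_prop) _ _) (fun x => ?_) zero_lt_one
    have := weight_pos hv l x
    positivity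
  refine ⟨mass v l * unitIntegral ℝ (w * w * w), mul_pos (mass_pos hc hv l) hpos, ?_⟩
  have h5 := (hasDerivAt_id l).mul (hm.pow 2)
  refine h5.congr_deriv ?_
  rw [← hcube]
  simp only [id, Pi.pow_apply]
  push_cast
  ring

lemma continuous_freqRatio (hc : Continuous v) (hv : ∀ x, 0 ≤ v x) : Continuous (freqRatio v) := by
  have := continuous_mass hc hv
  unfold freqRatio
  fun_prop

lemma strictMono_freqRatio (hc : Continuous v) (hv : ∀ x, 0 ≤ v x) :
    StrictMono (freqRatio v) := by
  refine StrictMonoOn.Iic_union_Ici (a := 0) ?_ ?_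
  · intro x hx y hy hxy
    simpa [freqRatio, mass_of_nonpos v hx, mass_of_nonpos v hy] using hxy
  · refine strictMonoOn_of_deriv_pos (convex_Ici 0) (continuous_freqRatio hc hv).continuousOn
      fun x hx => ?_
    rw [interior_Ici] at hx
    obtain ⟨D, hD, h⟩ := exists_hasDerivAt_freqRatio hc hv hx
    rwa [h.deriv]

/-- Near a zero `x₀` the quadratic bound gives `w(x₀ + y) ≥ 1 / (1 + √(lK) y)`, whose integral is
logarithmic. This is the divergence of the period at the separatrix. -/
lemma IsProfile.log_le_mass (h : IsProfile v) :
    ∃ K : ℝ, 1 ≤ K ∧ ∀ l, 0 < l → Real.log (1 + √(l * K)) ≤ √(l * K) * mass v l := by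
  obtain ⟨K, hK1, hK⟩ := h.exists_lipschitz_deriv
  obtain ⟨x₀, hx₀⟩ := h.exists_zero
  refine ⟨K, hK1, fun l hl => ?_⟩
  set s := √(l * K) with hs
  have hlK : 0 < l * K := by positivity
  have hs0 : 0 < s := Real.sqrt_pos.2 hlK
  have hw : Function.Periodic (weight v l) 1 := fun y => by simp only [weight, h.periodic y]
  have hcw := continuous_weight h.continuous h.nonneg l
  have hm : mass v l = ∫ y in (0 : ℝ)..1, weight v l (x₀ + y) := by
    have h1 := hw.intervalIntegral_add_eq 0 x₀
    rw [zero_add] at h1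
    rw [mass, h1, intervalIntegral.integral_comp_add_left (weight v l) x₀, add_zero]
  have hder : ∀ y ∈ Set.uIcc (0 : ℝ) 1,
      HasDerivAt (fun y => Real.log (1 + s * y) / s) (1 / (1 + s * y)) y := fun y hy => by
    rw [Set.uIcc_of_le zero_le_one] at hy
    have hpos : 0 < 1 + s * y := by have := mul_nonneg hs0.le hy.1; linarith
    have h1 : HasDerivAt (fun y => 1 + s * y) s y := by
      simpa using ((hasDerivAt_id y).const_mul s).const_add 1
    have h2 := (h1.log hpos.ne').div_const s
    refine h2.congr_deriv ?_
    field_simp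
  have hcont : ContinuousOn (fun y => 1 / (1 + s * y)) (Set.uIcc 0 1) := by
    refine ContinuousOn.div₀ continuousOn_const (by fun_prop) fun y hy => ?_
    rw [Set.uIcc_of_le zero_le_one] at hy
    have := mul_nonneg hs0.le hy.1
    linarith
  have hint := intervalIntegral.integral_eq_sub_of_hasDerivAt hder hcont.intervalIntegrable
  simp only [mul_one, mul_zero, add_zero, Real.log_one, zero_div, sub_zero] at hint
  have hle : ∫ y in (0 : ℝ)..1, 1 / (1 + s * y) ≤ mass v l := by
    rw [hm]
    refine intervalIntegral.integral_mono_on zero_le_one hcont.intervalIntegrable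
      (Continuous.intervalIntegrable (by fun_prop) _ _) fun y hy => ?_
    have hsy := mul_nonneg hs0.le hy.1
    have h1 := one_le_one_add_max_mul h.nonneg l (x₀ + y)
    rw [weight, ← one_div]
    refine one_div_le_one_div_of_le (Real.sqrt_pos.2 (by linarith)) ?_
    rw [max_eq_left hl.le]
    refine Real.sqrt_le_iff.2 ⟨by linarith, ?_⟩
    have h2 := mul_le_mul_of_nonneg_left (h.le_mul_sq hK (by linarith) hx₀ y) hl.le
    have h3 : s ^ 2 = l * K := Real.sq_sqrt hlK.le
    nlinarith
  rw [hint, div_le_iff₀ hs0] at hle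
  linarith

/-- At `+∞` the logarithmic bound gives `l W² ≥ log² (1 + √(lK)) / K`. At `-∞` the clamping makes
`freqRatio` the identity, so that the inverse exists on the whole line. -/
lemma IsProfile.surjective_freqRatio (h : IsProfile v) : Function.Surjective (freqRatio v) := by
  refine (continuous_freqRatio h.continuous h.nonneg).surjective ?_ ?_
  · obtain ⟨K, hK1, hK⟩ := h.log_le_mass
    have h1 : Tendsto (fun l => (Real.log (1 + √(l * K))) ^ 2 / K) atTop atTop := by
      refine Tendsto.atTop_div_const (by linarith) ?_
      refine (tendsto_pow_atTop two_ne_zero).comp (Real.tendsto_log_atTop.comp ?_)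
      refine tendsto_atTop_add_const_left _ _ (Real.tendsto_sqrt_atTop.comp ?_)
      exact tendsto_id.atTop_mul_const (by linarith)
    refine tendsto_atTop_mono' _ ?_ h1
    filter_upwards [eventually_gt_atTop 0] with l hl
    have h2 := hK l hl
    have h3 : 0 ≤ Real.log (1 + √(l * K)) := Real.log_nonneg (by linarith [Real.sqrt_nonneg (l * K)])
    have h4 := pow_le_pow_left₀ h3 h2 2
    rw [mul_pow, Real.sq_sqrt (by positivity)] at h4
    rw [div_le_iff₀ (by linarith), freqRatio]
    linarith
  · refine tendsto_id.congr' ?_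
    filter_upwards [eventually_le_atBot 0] with l hl
    simp [freqRatio, mass_of_nonpos v hl]

/-- `freqRatio` as an order isomorphism of the line. -/
noncomputable def IsProfile.freqIso (h : IsProfile v) : ℝ ≃o ℝ :=
  StrictMono.orderIsoOfSurjective _ (strictMono_freqRatio h.continuous h.nonneg)
    h.surjective_freqRatio

namespace IsProfile

lemma freqIso_apply (h : IsProfile v) (l : ℝ) : h.freqIso l = freqRatio v l := rfl

lemma freqRatio_symm (h : IsProfile v) (y : ℝ) : freqRatio v (h.freqIso.symm y) = y :=
  h.freqIso.apply_symm_apply y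

lemma freqIso_symm_zero (h : IsProfile v) : h.freqIso.symm 0 = 0 := by
  rw [OrderIso.symm_apply_eq, freqIso_apply]; simp [freqRatio]

lemma freqIso_symm_pos (h : IsProfile v) {y : ℝ} (hy : 0 < y) : 0 < h.freqIso.symm y := by
  rw [← h.freqIso_symm_zero]; exact h.freqIso.symm.strictMono hy

lemma freqIso_symm_nonneg (h : IsProfile v) {y : ℝ} (hy : 0 ≤ y) : 0 ≤ h.freqIso.symm y := by
  rw [← h.freqIso_symm_zero]; exact h.freqIso.symm.monotone hy

lemma analyticAt_freqIso_symm (h : IsProfile v) {y : ℝ} (hy : 0 < y) :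
    AnalyticAt ℝ h.freqIso.symm y := by
  set l := h.freqIso.symm y with hl
  have hl0 : 0 < l := h.freqIso_symm_pos hy
  obtain ⟨D, hD, hder⟩ := exists_hasDerivAt_freqRatio h.continuous h.nonneg hl0
  have hf : AnalyticAt ℝ (freqRatio v) l :=
    analyticAt_id.mul ((analyticAt_mass h.continuous h.nonneg hl0).pow 2)
  have hne : deriv (freqRatio v) l ≠ 0 := by rw [hder.deriv]; exact hD.ne'
  have hfl : freqRatio v l = y := h.freqRatio_symm y
  have h1 := hf.analyticAt_localInverse hne
  rw [hfl] at h1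
  refine h1.congr ?_
  have h2 := hf.hasStrictDerivAt.eventually_right_inverse hne
  rw [hfl] at h2
  filter_upwards [h2] with z hz
  rw [eq_comm, OrderIso.symm_apply_eq, freqIso_apply, hz]

end IsProfile

end Profile

/-! ### The period of the resonant torus and the energy ratios as functions of the parameters -/

section Scale

open scoped ContDiff

variable {ι : Type*} [Fintype ι] {v : ι → ℝ → ℝ} (hv : ∀ i, IsProfile (v i)) (e : ℝ) (β μ : ι → ℝ)

/-- The function whose zero is `2 T²`, where `T` is the period of the tori of energy `e` whose
frequencies have the squares `β_i / T²`. -/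
noncomputable def scaleFun (s : ℝ) : ℝ :=
  e * s - ∑ i, β i * mass (v i) ((hv i).freqIso.symm (s * max (μ i) 0 / β i)) ^ 2

variable {e β}

lemma strictMono_scaleFun (he : 0 < e) (hβ : ∀ i, 0 < β i) :
    StrictMono (scaleFun hv e β μ) := by
  intro s t hst
  suffices ∑ i, β i * mass (v i) ((hv i).freqIso.symm (t * max (μ i) 0 / β i)) ^ 2 ≤
      ∑ i, β i * mass (v i) ((hv i).freqIso.symm (s * max (μ i) 0 / β i)) ^ 2 by
    have := mul_lt_mul_of_pos_left hst he
    unfold scaleFun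
    linarith
  refine Finset.sum_le_sum fun i _ => ?_
  have h1 := (hβ i).le
  have h2 : (hv i).freqIso.symm (s * max (μ i) 0 / β i) ≤
      (hv i).freqIso.symm (t * max (μ i) 0 / β i) :=
    (hv i).freqIso.symm.monotone (by gcongr)
  have h3 := antitone_mass (hv i).continuous (hv i).nonneg h2
  have h4 := (mass_pos (hv i).continuous (hv i).nonneg
    ((hv i).freqIso.symm (t * max (μ i) 0 / β i))).le
  gcongr

lemma continuous_scaleFun_uncurry :
    Continuous fun z : (ι → ℝ) × ℝ => scaleFun hv e β z.1 z.2 := by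
  have h1 := fun i => continuous_mass (hv i).continuous (hv i).nonneg
  have h2 := fun i => (hv i).freqIso.symm.continuous
  unfold scaleFun
  refine (by fun_prop : Continuous fun z : (ι → ℝ) × ℝ => e * z.2).sub
    (continuous_finsetSum _ fun i _ => ?_)
  refine continuous_const.mul (((h1 i).comp ((h2 i).comp ?_)).pow 2)
  exact Continuous.div_const (by fun_prop) _

/-- At `s = 0` all masses are `1` and the value is `-∑ β_i`; at `s = (∑ β_i) / e` it is
non-negative, as masses are at most `1`. -/
lemma exists_scaleFun_eq_zero [Nonempty ι] (he : 0 < e) (hβ : ∀ i, 0 < β i) :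
    ∃ s, 0 < s ∧ scaleFun hv e β μ s = 0 := by
  have hc : Continuous (scaleFun hv e β μ) :=
    (continuous_scaleFun_uncurry hv).comp (by fun_prop : Continuous fun s : ℝ => (μ, s))
  have hS : 0 < ∑ i, β i := Finset.sum_pos (fun i _ => hβ i) Finset.univ_nonempty
  have h0 : scaleFun hv e β μ 0 < 0 := by
    simp [scaleFun, IsProfile.freqIso_symm_zero, mass_of_nonpos _ le_rfl, hS]
  have h1 : 0 ≤ scaleFun hv e β μ ((∑ i, β i) / e) := by
    rw [scaleFun, mul_div_cancel₀ _ he.ne', sub_nonneg]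
    refine Finset.sum_le_sum fun i _ => mul_le_of_le_one_right (hβ i).le (pow_le_one₀ ?_ ?_)
    · exact (mass_pos (hv i).continuous (hv i).nonneg _).le
    · exact mass_le_one (hv i).continuous (hv i).nonneg _
  have hle : 0 ≤ (∑ i, β i) / e := by positivity
  obtain ⟨s, hs, hs0⟩ := intermediate_value_Icc hle hc.continuousOn ⟨h0.le, h1⟩
  refine ⟨s, lt_of_le_of_ne hs.1 ?_, hs0⟩
  rintro rfl
  exact h0.ne hs0

variable [Nonempty ι] (he : 0 < e) (hβ : ∀ i, 0 < β i)

/-- The zero of `scaleFun`. -/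
noncomputable def scale : ℝ := (exists_scaleFun_eq_zero hv μ he hβ).choose

lemma scale_pos : 0 < scale hv μ he hβ := (exists_scaleFun_eq_zero hv μ he hβ).choose_spec.1

lemma scaleFun_scale : scaleFun hv e β μ (scale hv μ he hβ) = 0 :=
  (exists_scaleFun_eq_zero hv μ he hβ).choose_spec.2

lemma eq_scale {s : ℝ} (hs : scaleFun hv e β μ s = 0) : s = scale hv μ he hβ :=
  (strictMono_scaleFun hv μ he hβ).injective (hs.trans (scaleFun_scale hv μ he hβ).symm)

/-- By strict monotonicity the zero exceeds `a` exactly when `scaleFun` is negative at `a`, which is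
an open condition on `μ`. -/
lemma measurable_scale : Measurable fun μ => scale hv μ he hβ := by
  refine measurable_of_Ioi fun a => ?_
  have : (fun μ => scale hv μ he hβ) ⁻¹' Set.Ioi a = {μ | scaleFun hv e β μ a < 0} := by
    ext μ
    rw [Set.mem_preimage, Set.mem_Ioi, Set.mem_ofPred_eq, ← scaleFun_scale hv μ he hβ]
    exact (strictMono_scaleFun hv μ he hβ).lt_iff_lt.symm
  rw [this]
  have hc : Continuous fun μ => scaleFun hv e β μ a :=
    (continuous_scaleFun_uncurry hv).comp (by fun_prop : Continuous fun μ : ι → ℝ => (μ, a))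
  exact (isOpen_lt hc continuous_const).measurableSet

/-- The ratio of `μ_i` and of the energy in the `i`-th degree of freedom. -/
noncomputable def level (i : ι) : ℝ :=
  (hv i).freqIso.symm (scale hv μ he hβ * max (μ i) 0 / β i)

lemma level_nonneg (i : ι) : 0 ≤ level hv μ he hβ i :=
  (hv i).freqIso_symm_nonneg
    (div_nonneg (mul_nonneg (scale_pos hv μ he hβ).le (le_max_right _ _)) (hβ i).le)

lemma level_of_eq_zero {i : ι} (h : μ i = 0) : level hv μ he hβ i = 0 := by
  simp [level, h, IsProfile.freqIso_symm_zero]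

lemma measurable_level (i : ι) : Measurable fun μ => level hv μ he hβ i := by
  refine (hv i).freqIso.symm.continuous.measurable.comp ?_
  have := measurable_scale hv he hβ
  fun_prop

/-- Since `e s ≤ ∑ β_j`, comparability of `β_i` with this sum gives `l W² C ≤ η`. With `W² ≥ 1 / (1
+ l C)` this becomes `l C ≤ η (1 + l C)`, and `η ≤ 1/2` closes the estimate. -/
lemma level_mul_le {i : ι} {C η κ : ℝ} (hμ : 0 ≤ μ i) (hC : ∀ x, v i x ≤ C) (hκ : 0 < κ)
    (hβκ : κ * ∑ j, β j ≤ β i) (hη : η ≤ 1 / 2) (h : μ i * C ≤ η * (e * κ)) :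
    level hv μ he hβ i * C ≤ 2 * η := by
  set l := level hv μ he hβ i with hl
  set s := scale hv μ he hβ with hs
  have hl0 : 0 ≤ l := level_nonneg hv μ he hβ i
  have hC0 : 0 ≤ C := ((hv i).nonneg 0).trans (hC 0)
  have h1 : l * mass (v i) l ^ 2 = s * μ i / β i := by
    have := (hv i).freqRatio_symm (s * max (μ i) 0 / β i)
    rw [hl, level, ← hs]
    rwa [max_eq_left hμ] at this ⊢
  have h2 : e * s ≤ ∑ j, β j := by
    have h3 := scaleFun_scale hv μ he hβ
    rw [scaleFun, sub_eq_zero] at h3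
    rw [h3]
    refine Finset.sum_le_sum fun j _ => mul_le_of_le_one_right (hβ j).le (pow_le_one₀ ?_ ?_)
    · exact (mass_pos (hv j).continuous (hv j).nonneg _).le
    · exact mass_le_one (hv j).continuous (hv j).nonneg _
  have h3 : 1 ≤ mass (v i) l ^ 2 * (1 + l * C) := by
    have h4 := inv_sqrt_le_mass (hv i).continuous (hv i).nonneg hl0 hC
    have h5 : 0 < 1 + l * C := by positivity
    have h6 := pow_le_pow_left₀ (by positivity) h4 2
    rw [inv_pow, Real.sq_sqrt h5.le, inv_le_iff_one_le_mul₀ h5] at h6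
    exact h6
  have h4 : κ * (e * s) ≤ β i := (mul_le_mul_of_nonneg_left h2 hκ.le).trans hβκ
  have hs0 : 0 < s := scale_pos hv μ he hβ
  have h5 : l * mass (v i) l ^ 2 * C ≤ η := by
    rw [h1, div_mul_eq_mul_div, div_le_iff₀ (hβ i)]
    have h7 : 0 ≤ η := by
      have : 0 ≤ η * (e * κ) := (mul_nonneg hμ hC0).trans h
      exact nonneg_of_mul_nonneg_left this (by positivity)
    calc s * μ i * C = s * (μ i * C) := by ring
      _ ≤ s * (η * (e * κ)) := by gcongr
      _ = η * (κ * (e * s)) := by ring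
      _ ≤ η * β i := by gcongr
  have h6 : l * C ≤ η * (1 + l * C) := by
    calc l * C = l * C * 1 := by ring
      _ ≤ l * C * (mass (v i) l ^ 2 * (1 + l * C)) := by gcongr
      _ = l * mass (v i) l ^ 2 * C * (1 + l * C) := by ring
      _ ≤ η * (1 + l * C) := by gcongr
  nlinarith [mul_nonneg hl0 hC0]

/-! ### Analytic dependence along curves of parameters -/

variable {m : ℝ → ι → ℝ} {t₀ : ℝ}

/-- Implicit function theorem for `scaleFun`. A parameter must be either locally zero or positive,
because the dependence on `max (μ i) 0` need not be analytic at `0`. -/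
lemma analyticAt_scale (hm : ∀ i, (∀ᶠ t in 𝓝 t₀, m t i = 0) ∨
      (0 < m t₀ i ∧ AnalyticAt ℝ (fun t => m t i) t₀)) :
    AnalyticAt ℝ (fun t => scale hv (m t) he hβ) t₀ := by
  set s₀ := scale hv (m t₀) he hβ with hs₀
  have hs0 : 0 < s₀ := scale_pos hv (m t₀) he hβ
  set F : ℝ × ℝ → ℝ := fun z => scaleFun hv e β (m z.1) z.2 with hF
  have hFa : AnalyticAt ℝ F (t₀, s₀) := by
    have hterm : ∀ i, AnalyticAt ℝ (fun z : ℝ × ℝ =>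
        β i * mass (v i) ((hv i).freqIso.symm (z.2 * max (m z.1 i) 0 / β i)) ^ 2) (t₀, s₀) := by
      intro i
      rcases hm i with h | ⟨h, ha⟩
      · refine (analyticAt_const (v := β i * 1)).congr ?_
        filter_upwards [continuousAt_fst.eventually h] with z hz
        simp [hz, IsProfile.freqIso_symm_zero, mass_of_nonpos _ le_rfl]
      · have h1 : AnalyticAt ℝ (fun z : ℝ × ℝ => m z.1 i) (t₀, s₀) :=
          ha.comp_of_eq analyticAt_fst rfl
        have h2 : AnalyticAt ℝ (fun z : ℝ × ℝ => z.2 * max (m z.1 i) 0 / β i) (t₀, s₀) := by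
          refine ((analyticAt_snd.mul h1).div_const (c := β i)).congr ?_
          filter_upwards [h1.continuousAt.eventually (lt_mem_nhds h)] with z hz
          simp only [Pi.mul_apply]
          rw [max_eq_left (le_of_lt hz)]
        have hy : 0 < s₀ * max (m t₀ i) 0 / β i :=
          div_pos (mul_pos hs0 (lt_max_of_lt_left h)) (hβ i)
        have h3 := ((hv i).analyticAt_freqIso_symm hy).comp_of_eq h2 rfl
        have h4 := (analyticAt_mass (hv i).continuous (hv i).nonneg
          ((hv i).freqIso_symm_pos hy)).comp_of_eq h3 rfl
        exact analyticAt_const.mul (h4.pow 2)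
    have h1 : AnalyticAt ℝ (fun z : ℝ × ℝ => ∑ i,
        β i * mass (v i) ((hv i).freqIso.symm (z.2 * max (m z.1 i) 0 / β i)) ^ 2) (t₀, s₀) :=
      Finset.univ.analyticAt_fun_sum fun i _ => hterm i
    exact (analyticAt_const.mul analyticAt_snd).sub h1
  have cdf : ContDiffAt ℝ ω F (t₀, s₀) := hFa.contDiffAt
  have hinvert : (fderiv ℝ F (t₀, s₀) ∘L .inr ℝ ℝ ℝ).IsInvertible := by
    set L := fderiv ℝ F (t₀, s₀) ∘L .inr ℝ ℝ ℝ with hL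
    have h1 : HasFDerivAt (fun s => F (t₀, s)) L s₀ :=
      HasFDerivAt.comp s₀ (g := F) hFa.differentiableAt.hasFDerivAt
        (hasFDerivAt_prodMk_right t₀ s₀)
    have h2 : HasDerivAt (fun s => F (t₀, s) - (e / 2) * s) (L 1 - e / 2 * 1) s₀ :=
      h1.hasDerivAt.sub ((hasDerivAt_id s₀).const_mul (e / 2))
    -- Subtracting `(e/2) s` leaves `scaleFun` for the energy `e/2`, still monotone; so the
    -- `s`-derivative is at least `e/2`.
    have h3 : Monotone fun s => F (t₀, s) - (e / 2) * s := by
      convert! (strictMono_scaleFun hv (m t₀) (half_pos he) hβ).monotone using 2 with s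
      simp only [hF, scaleFun]
      ring
    have h4 : 0 < L 1 := by
      have := h2.deriv ▸ h3.deriv_nonneg (x := s₀)
      linarith
    refine ⟨ContinuousLinearEquiv.unitsEquivAut ℝ (Units.mk0 (L 1) h4.ne'), ?_⟩
    ext
    simp
  have h1 := cdf.contDiffAt_implicitFunction (by simp) hinvert
  refine h1.analyticAt.congr ?_
  have h2 := cdf.eventually_apply_implicitFunction (by simp) hinvert
  filter_upwards [h2] with t ht
  exact eq_scale hv (m t) he hβ (ht.trans (scaleFun_scale hv (m t₀) he hβ))

lemma analyticAt_modeCoeff_level (hm : ∀ i, (∀ᶠ t in 𝓝 t₀, m t i = 0) ∨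
      (0 < m t₀ i ∧ AnalyticAt ℝ (fun t => m t i) t₀)) (i : ι) (k n : ℤ) :
    AnalyticAt ℝ (fun t => modeCoeff (v i) (level hv (m t) he hβ i) k n) t₀ := by
  rcases hm i with h | ⟨h, ha⟩
  · refine (analyticAt_const (v := modeCoeff (v i) 0 k n)).congr ?_
    filter_upwards [h] with t ht
    rw [level_of_eq_zero hv (m t) he hβ ht]
  · have h2 : AnalyticAt ℝ (fun t => scale hv (m t) he hβ * max (m t i) 0 / β i) t₀ := by
      refine (((analyticAt_scale hv he hβ hm).mul ha).div_const (c := β i)).congr ?_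
      filter_upwards [ha.continuousAt.eventually (lt_mem_nhds h)] with t ht
      simp only [Pi.mul_apply]
      rw [max_eq_left (le_of_lt ht)]
    have hy : 0 < scale hv (m t₀) he hβ * max (m t₀ i) 0 / β i :=
      div_pos (mul_pos (scale_pos _ _ _ _) (lt_max_of_lt_left h)) (hβ i)
    have h3 := ((hv i).analyticAt_freqIso_symm hy).comp_of_eq h2 rfl
    exact (analyticAt_modeCoeff (hv i).continuous (hv i).nonneg k n
      ((hv i).freqIso_symm_pos hy)).comp_of_eq h3 rfl

end Scale

/-! ### One-dimensional motions that go around the circle -/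

section OneDim

variable {v : ℝ → ℝ} {μ T : ℝ} {q p : ℝ → ℝ} {n : ℤ}

lemma apply_int_mul_of_translation (hper : ∀ t, q (t + T) = q t + n) (hT : T ≠ 0) (t : ℝ) (j : ℤ) :
    q (t + j * T) = q t + j * n := by
  have h : Function.Periodic (fun t => q t - t * (n / T)) T := fun t => by
    simp only [hper]; field_simp; ring
  have h1 := h.int_mul j t
  have h2 : (j * T) * (n / T) = j * n := by field_simp
  linarith [add_mul t (j * T) (n / T)]

lemma surjective_of_translation (hq : Continuous q) (hper : ∀ t, q (t + T) = q t + n)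
    (hT : T ≠ 0) (hn : n ≠ 0) : Function.Surjective q := by
  intro y
  have hn2 : (1 : ℝ) ≤ (n : ℝ) * n := by
    have h1 : 0 < n * n := mul_self_pos.2 hn
    exact_mod_cast h1
  set N := ⌈|y - q 0|⌉ with hN
  have h1 : |y - q 0| ≤ N := Int.le_ceil _
  have h2 : (N : ℝ) ≤ N * (n * n) := le_mul_of_one_le_right ((abs_nonneg _).trans h1) hn2
  obtain ⟨h3, h4⟩ := abs_le.1 h1
  -- After `± N n` periods the displacement is `± N n²`; the square makes the sign of `n`
  -- irrelevant.
  refine mem_range_of_exists_le_of_exists_ge hq ⟨0 + ((-(N * n) : ℤ) : ℝ) * T, ?_⟩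
    ⟨0 + ((N * n : ℤ) : ℝ) * T, ?_⟩
  · rw [apply_int_mul_of_translation hper hT]; push_cast; linarith
  · rw [apply_int_mul_of_translation hper hT]; push_cast; linarith

/-- A trajectory which starts at rest at a zero of the potential stays there. -/
lemma eq_of_rest (h : IsProfile v) (hμ : 0 ≤ μ) (hq : ∀ t, HasDerivAt q (p t) t)
    (hp : ∀ t, HasDerivAt p (μ * deriv v (q t)) t) {t₀ t : ℝ} (hv : v (q t₀) = 0)
    (hp0 : p t₀ = 0) (ht : t₀ ≤ t) : q t = q t₀ := by
  obtain ⟨K, hK1, hK⟩ := h.exists_lipschitz_deriv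
  have hd : ∀ s, HasDerivAt (fun s => (q s - q t₀, p s)) (p s, μ * deriv v (q s)) s :=
    fun s => ((hq s).sub_const _).prodMk (hp s)
  have := eq_zero_of_abs_deriv_le_mul_abs_self_of_eq_zero_right
    (f := fun s => (q s - q t₀, p s)) (f' := fun s => (p s, μ * deriv v (q s)))
    (K := 1 + μ * K) (a := t₀) (b := t)
    (fun s _ => (hd s).continuousAt.continuousWithinAt)
    (fun s _ => (hd s).hasDerivWithinAt) (by simp [hp0]) (fun s _ => by
      have h1 : ‖q s - q t₀‖ ≤ ‖(q s - q t₀, p s)‖ := norm_fst_le (q s - q t₀, p s)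
      have h2 : ‖p s‖ ≤ ‖(q s - q t₀, p s)‖ := norm_snd_le (q s - q t₀, p s)
      have h3 : 0 ≤ ‖(q s - q t₀, p s)‖ := norm_nonneg _
      have h4 : 0 ≤ μ * K := by positivity
      refine norm_prod_le_iff.2 ⟨by nlinarith, ?_⟩
      have h5 := hK (q s) (q t₀)
      rw [h.deriv_eq_zero hv, sub_zero] at h5
      rw [norm_mul, Real.norm_of_nonneg hμ]
      calc μ * ‖deriv v (q s)‖ ≤ μ * (K * ‖(q s - q t₀, p s)‖) := by
            refine mul_le_mul_of_nonneg_left (h5.trans ?_) hμ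
            exact mul_le_mul_of_nonneg_left h1 (by linarith)
        _ ≤ (1 + μ * K) * ‖(q s - q t₀, p s)‖ := by nlinarith) t (Set.right_mem_Icc.2 ht)
  exact sub_eq_zero.1 (congrArg Prod.fst this)

/-- The motion in the potential `-μ v` that advances by `n ≠ 0` periods in time `T`. -/
lemma exists_energy_of_translation (h : IsProfile v) (hμ : 0 ≤ μ)
    (hq : ∀ t, HasDerivAt q (p t) t) (hp : ∀ t, HasDerivAt p (μ * deriv v (q t)) t)
    (hn : n ≠ 0) (hT : T ≠ 0) (hper : ∀ t, q (t + T) = q t + n) :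
    ∃ E, 0 < E ∧ (∀ t, p t ^ 2 / 2 - μ * v (q t) = E) ∧
      2 * E * T ^ 2 = n ^ 2 * mass v (μ / E) ^ 2 ∧
      ∀ t, angle v (μ / E) (q t) = angle v (μ / E) (q 0) + t * (n / T) := by
  set E := p 0 ^ 2 / 2 - μ * v (q 0) with hE
  have hcons : ∀ t, p t ^ 2 / 2 - μ * v (q t) = E := by
    have hd : ∀ t, HasDerivAt (fun t => p t ^ 2 / 2 - μ * v (q t)) 0 t := fun t => by
      have h1 := (((hp t).pow 2).div_const 2).sub
        (((h.hasDerivAt (q t)).comp t (hq t)).const_mul μ)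
      refine h1.congr_deriv ?_
      push_cast
      ring
    intro t
    exact is_const_of_deriv_eq_zero (fun t => (hd t).differentiableAt) (fun t => (hd t).deriv) t 0
  have hqc : Continuous q := continuous_iff_continuousAt.2 fun t => (hq t).continuousAt
  have hpc : Continuous p := continuous_iff_continuousAt.2 fun t => (hp t).continuousAt
  obtain ⟨x₀, hx₀⟩ := h.exists_zero
  obtain ⟨t₀, rfl⟩ := surjective_of_translation hqc hper hT hn x₀
  have hE0 : 0 < E := by
    have h1 := hcons t₀
    rw [hx₀, mul_zero, sub_zero] at h1
    -- The motion passes over a minimum of `v`, an equilibrium. Zero momentum there would mean rest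
    -- forever after, against the translation by `n ≠ 0`; for `T < 0` the translation by `-T` is
    -- used.
    have h2 : p t₀ ≠ 0 := fun h0 => by
      have hn' : (n : ℝ) ≠ 0 := by exact_mod_cast hn
      rcases lt_or_gt_of_ne hT with hT' | hT'
      · have h3 := eq_of_rest h hμ hq hp hx₀ h0 (t := t₀ + ((-1 : ℤ) : ℝ) * T)
          (by push_cast; linarith)
        rw [apply_int_mul_of_translation hper hT] at h3
        push_cast at h3
        exact hn' (by linarith)
      · have h3 := eq_of_rest h hμ hq hp hx₀ h0 (t := t₀ + T) (by linarith)
        rw [hper] at h3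
        exact hn' (by linarith)
    rw [← h1]; positivity
  refine ⟨E, hE0, hcons, ?_⟩
  set l := μ / E with hl
  have hl0 : 0 ≤ l := by positivity
  have hm := mass_pos h.continuous h.nonneg l
  have hsq : ∀ t, (weight v l (q t) * p t) ^ 2 = 2 * E := fun t => by
    have h1 := weight_sq_mul h.nonneg hl0 (q t)
    have h2 : p t ^ 2 = 2 * E * (1 + l * v (q t)) := by
      have h3 := hcons t
      have h4 : E * l = μ := by rw [hl]; field_simp
      linear_combination 2 * h3 - 2 * v (q t) * h4
    rw [mul_pow, h2]
    linear_combination 2 * E * h1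
  have hwc := continuous_weight h.continuous h.nonneg l
  -- The square is the positive constant `2E`, so by the intermediate value theorem the sign cannot
  -- change.
  have hconst : ∀ t, weight v l (q t) * p t = weight v l (q 0) * p 0 := by
    have hcont : Continuous fun t => weight v l (q t) * p t := by fun_prop
    intro t
    by_contra hne
    have h1 : weight v l (q t) * p t = -(weight v l (q 0) * p 0) :=
      (sq_eq_sq_iff_eq_or_eq_neg.1 ((hsq t).trans (hsq 0).symm)).resolve_left hne
    have h2 : (0 : ℝ) ∈ Set.range fun t => weight v l (q t) * p t := by
      rcases le_total 0 (weight v l (q 0) * p 0) with h3 | h3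
      · exact mem_range_of_exists_le_of_exists_ge hcont ⟨t, by linarith⟩ ⟨0, h3⟩
      · exact mem_range_of_exists_le_of_exists_ge hcont ⟨0, h3⟩ ⟨t, by linarith⟩
    obtain ⟨s, hs⟩ := h2
    have h3 := hsq s
    simp only at hs
    rw [hs] at h3
    linarith
  set D := weight v l (q 0) * p 0 / mass v l with hD
  have hlin : ∀ t, angle v l (q t) = angle v l (q 0) + t * D := by
    have hd : ∀ t, HasDerivAt (fun t => angle v l (q t) - t * D) 0 t := fun t => by
      have h1 := ((hasDerivAt_angle h.continuous h.nonneg l (q t)).comp t (hq t)).sub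
        ((hasDerivAt_id t).mul_const D)
      refine h1.congr_deriv ?_
      rw [hD, ← hconst t]
      ring
    intro t
    have := is_const_of_deriv_eq_zero (fun t => (hd t).differentiableAt) (fun t => (hd t).deriv) t 0
    simp only [zero_mul, sub_zero] at this
    linarith
  -- The constant angular speed is fixed by the advance of `n` in time `T`.
  have hDT : T * D = n := by
    have h1 := hlin (0 + T)
    rw [hper, angle_add_int h.continuous h.nonneg h.periodic, zero_add] at h1
    linarith
  have hDeq : D = n / T := by rw [eq_div_iff hT]; linarith
  refine ⟨?_, fun t => by rw [hlin t, hDeq]⟩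
  have h1 := hsq 0
  have h2 : weight v l (q 0) * p 0 = D * mass v l := by rw [hD]; field_simp
  rw [h2] at h1
  rw [← hDT, ← h1]
  ring

end OneDim

/-! ### Lifts and gradients on the torus, and the Hamilton-Jacobi equation -/

section Torus

variable {d : ℕ}

lemma isOpenQuotientMap_proj : IsOpenQuotientMap (proj : (Fin d → ℝ) → UnitAddTorus (Fin d)) :=
  IsOpenQuotientMap.piMap fun _ => QuotientAddGroup.isOpenQuotientMap_mk

lemma continuous_of_continuous_lift {f : UnitAddTorus (Fin d) → ℝ} (h : Continuous (lift f)) :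
    Continuous f :=
  isOpenQuotientMap_proj.continuous_comp_iff.1 h

lemma proj_add_int (x : Fin d → ℝ) (k : Fin d → ℤ) :
    proj (x + fun i => (k i : ℝ)) = proj x := by
  funext i
  have h : ((k i : ℝ) : UnitAddCircle) = 0 := AddCircle.coe_eq_zero_iff 1 |>.2 ⟨k i, by simp⟩
  simp only [proj, Pi.add_apply, AddCircle.coe_add, h, add_zero]

lemma lift_add_int (f : UnitAddTorus (Fin d) → ℝ) (x : Fin d → ℝ) (k : Fin d → ℤ) :
    lift f (x + fun i => (k i : ℝ)) = lift f x := by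
  rw [lift, proj_add_int, lift]

lemma fderiv_lift_apply (f : UnitAddTorus (Fin d) → ℝ) (x y : Fin d → ℝ) :
    fderiv ℝ (lift f) x y = ∑ i, y i * grad f x i := by
  conv_lhs => rw [pi_eq_sum_univ y]
  simp only [map_sum, map_smul, smul_eq_mul, grad]
  refine Finset.sum_congr rfl fun i _ => ?_
  congr 2
  funext j
  simp [Pi.single_apply, eq_comm]

lemma abs_grad_le (f : UnitAddTorus (Fin d) → ℝ) (x : Fin d → ℝ) (i : Fin d) :
    |grad f x i| ≤ ‖fderiv ℝ (lift f) x‖ := by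
  have := (fderiv ℝ (lift f) x).le_opNorm (Pi.single i 1)
  rwa [Pi.norm_single, norm_one, mul_one] at this

lemma hasDerivAt_lift_comp {f : UnitAddTorus (Fin d) → ℝ} (hf : ContDiff ℝ 1 (lift f))
    {γ : ℝ → Fin d → ℝ} {γ' : Fin d → ℝ} {t : ℝ} (hγ : HasDerivAt γ γ' t) :
    HasDerivAt (fun t => lift f (γ t)) (∑ i, γ' i * grad f (γ t) i) t := by
  rw [← fderiv_lift_apply]
  exact ((hf.differentiable (by simp)) (γ t)).hasFDerivAt.comp_hasDerivAt t hγ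

lemma grad_sub_add_mul {f g h : UnitAddTorus (Fin d) → ℝ} (hf : ContDiff ℝ 1 (lift f))
    (hg : ContDiff ℝ 1 (lift g)) (hh : ContDiff ℝ 1 (lift h)) (ε : ℝ) (x : Fin d → ℝ) (i : Fin d) :
    grad (fun x => f x - (g x + ε * h x)) x i = grad f x i - (grad g x i + ε * grad h x i) := by
  have hf' := (hf.differentiable (by simp) x).hasFDerivAt
  have hg' := (hg.differentiable (by simp) x).hasFDerivAt
  have hh' := (hh.differentiable (by simp) x).hasFDerivAt
  have h1 : HasFDerivAt (lift fun x => f x - (g x + ε * h x))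
      (fderiv ℝ (lift f) x - (fderiv ℝ (lift g) x + ε • fderiv ℝ (lift h) x)) x :=
    hf'.sub (hg'.add (hh'.const_mul ε))
  simp [grad, h1.fderiv]

/-! ### The first order expansion of the Hamilton-Jacobi equation -/

lemma eq_zero_of_isBigO_sq {ε : ℕ → ℝ} (hε : ∀ n, ε n ≠ 0) (hε0 : Tendsto ε atTop (𝓝 0)) {x y : ℝ}
    (h : (fun n => x + ε n * y) =O[atTop] fun n => ε n ^ 2) : x = 0 ∧ y = 0 := by
  have h2 : Tendsto (fun n => ε n ^ 2) atTop (𝓝 0) := by simpa using hε0.pow 2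
  have hx : x = 0 := by
    have h3 := h.trans_tendsto h2
    have h4 : Tendsto (fun n => x + ε n * y) atTop (𝓝 (x + 0 * y)) :=
      tendsto_const_nhds.add (hε0.mul_const y)
    simpa using tendsto_nhds_unique h4 h3
  refine ⟨hx, ?_⟩
  subst hx
  have h3 : (fun _ : ℕ => y) =O[atTop] ε := by
    have h4 := (Asymptotics.isBigO_refl (fun n => (ε n)⁻¹) atTop).mul h
    refine (h4.congr' (Eventually.of_forall fun n => ?_) (Eventually.of_forall fun n => ?_))
    · have := hε n; field_simp; simp
    · have := hε n; field_simp
  exact tendsto_nhds_unique tendsto_const_nhds (h3.trans_tendsto hε0)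

/-- The `C^{1,1}` expansion controls gradients pointwise up to `O(ε²)`, so the coefficients of order
`0` and `1` in the Hamilton-Jacobi equation can be compared. The order-one equation is a transport
equation for `u₁`. -/
lemma IsPreserved.exists_first_order {V : Fin d → UnitAddCircle → ℝ} {μ : Fin d → ℝ}
    {U : UnitAddTorus (Fin d) → ℝ} {ε : ℕ → ℝ} {c : Fin d → ℝ} (h : IsPreserved V μ U ε c)
    (hε : ∀ n, ε n ≠ 0) (hε0 : Tendsto ε atTop (𝓝 0)) :
    ∃ u₀ u₁ : UnitAddTorus (Fin d) → ℝ, ∃ a₀ a₁ : ℝ, ContDiff ℝ 1 (lift u₀) ∧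
      ContDiff ℝ 1 (lift u₁) ∧ SolvesHJ (energyPotential V μ 0 0) c u₀ a₀ ∧
      ∀ x, ∑ i, (c + grad u₀ x) i * grad u₁ x i + U (proj x) = a₁ := by
  obtain ⟨u, hu, ⟨u₀, u₁, hu₀, hu₁, K, hK⟩, a₀, a₁, K', hK'⟩ := h
  refine ⟨u₀, u₁, a₀, a₁, hu₀.1, hu₁.1, ?_⟩
  set α := fun n => matherAlpha (energyPotential V μ U (ε n)) c with hα
  have key : ∀ x, hamiltonian (energyPotential V μ 0 0) (proj x) (c + grad u₀ x) - a₀ = 0 ∧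
      ∑ i, (c + grad u₀ x) i * grad u₁ x i + U (proj x) - a₁ = 0 := by
    intro x
    refine eq_zero_of_isBigO_sq hε hε0 ?_
    set A := c + grad u₀ x with hA
    set B := grad u₁ x with hB
    have hsq2 : (fun n => ε n ^ 2) =O[atTop] fun _ : ℕ => (1 : ℝ) := by
      have : Tendsto (fun n => ε n ^ 2) atTop (𝓝 0) := by simpa using hε0.pow 2
      exact this.isBigO_one ℝ
    have hε1 : ε =O[atTop] fun _ : ℕ => (1 : ℝ) := hε0.isBigO_one ℝ
    have hP : ∀ i, (fun n => (c + grad (u n) x) i - (A i + ε n * B i)) =O[atTop]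
        fun n => ε n ^ 2 := fun i => by
      refine Asymptotics.IsBigO.of_bound K (Eventually.of_forall fun n => ?_)
      have h1 := (abs_grad_le (fun x => u n x - (u₀ x + ε n * u₁ x)) x i).trans ((hK n).2.2.1 x)
      rw [grad_sub_add_mul (hu n).1.1 hu₀.1 hu₁.1] at h1
      rw [Real.norm_eq_abs, Real.norm_of_nonneg (sq_nonneg _),
        show (c + grad (u n) x) i - (A i + ε n * B i) =
          grad (u n) x i - (grad u₀ x i + ε n * grad u₁ x i) by
            simp only [hA, hB, Pi.add_apply]; ring]
      exact h1
    have hP2 : ∀ i, (fun n => (c + grad (u n) x) i ^ 2 / 2 - (A i ^ 2 / 2 + ε n * (A i * B i)))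
        =O[atTop] fun n => ε n ^ 2 := fun i => by
      -- For the momentum `P` and `Q = A + ε B`, `P² - Q² = (P - Q)(P - Q + 2Q)`: the first factor
      -- is `O(ε²)` and this bounds the second.
      have h1 : (fun n => (c + grad (u n) x) i - (A i + ε n * B i) + 2 * (A i + ε n * B i))
          =O[atTop] fun _ : ℕ => (1 : ℝ) := by
        refine ((hP i).trans hsq2).add ?_
        refine Asymptotics.IsBigO.const_mul_left ?_ 2
        refine (Asymptotics.isBigO_const_const _ one_ne_zero _).add ?_
        simpa [mul_comm] using hε1.const_mul_left (B i)
      have h2 := ((hP i).mul h1).const_mul_left (1 / 2)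
      have h3 : (fun n => B i ^ 2 / 2 * ε n ^ 2) =O[atTop] fun n => ε n ^ 2 :=
        (Asymptotics.isBigO_refl _ _).const_mul_left _
      refine ((h2.trans ?_).add h3).congr_left fun n => ?_
      · simpa using Asymptotics.isBigO_refl (fun n => ε n ^ 2) atTop
      · ring
    have hα' : (fun n => α n - (a₀ + ε n * a₁)) =O[atTop] fun n => ε n ^ 2 :=
      Asymptotics.IsBigO.of_bound K' (Eventually.of_forall fun n => by
        rw [Real.norm_eq_abs, Real.norm_of_nonneg (sq_nonneg _)]; exact hK' n)
    have hsum := Asymptotics.IsBigO.fun_sum (s := Finset.univ) fun i _ => hP2 i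
    refine (hα'.sub hsum).congr_left fun n => ?_
    have h4 := (hu n).2.2 x
    simp only [hamiltonian, energyPotential, Pi.zero_apply, mul_zero, add_zero] at h4 ⊢
    simp only [Finset.sum_sub_distrib, Finset.sum_add_distrib, ← Finset.mul_sum, hα]
    linear_combination -h4
  exact ⟨fun x => sub_eq_zero.1 (key x).1, fun x => sub_eq_zero.1 (key x).2⟩

/-! ### Uniqueness of classical solutions which are invariant under a periodic flow -/

/-- A closed orbit of the flow `γ' = c + ∇u(γ)` on the torus. -/
structure IsClosedOrbit (c : Fin d → ℝ) (u : UnitAddTorus (Fin d) → ℝ) (T : ℝ) (b : Fin d → ℤ)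
    (γ : ℝ → Fin d → ℝ) : Prop where
  hasDerivAt : ∀ t, HasDerivAt γ (c + grad u (γ t)) t
  translation : ∀ t, γ (t + T) = γ t + fun i => (b i : ℝ)

/-- At a maximum of `u - w` on the compact torus the gradients agree. Hence two classical solutions
with the same `c` have the same constant. -/
lemma exists_grad_eq {u w : UnitAddTorus (Fin d) → ℝ} (hu : ContDiff ℝ 1 (lift u))
    (hw : ContDiff ℝ 1 (lift w)) : ∃ x, grad u x = grad w x := by
  have hc : Continuous fun x => u x - w x :=
    (continuous_of_continuous_lift hu.continuous).sub
      (continuous_of_continuous_lift hw.continuous)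
  obtain ⟨z, -, hz⟩ := isCompact_univ.exists_isMaxOn Set.univ_nonempty hc.continuousOn
  obtain ⟨x, rfl⟩ := isOpenQuotientMap_proj.surjective z
  refine ⟨x, ?_⟩
  have hmax : IsLocalMax (fun y => lift u y - lift w y) x :=
    Eventually.of_forall fun y => hz (Set.mem_univ (proj y))
  have h1 := hmax.fderiv_eq_zero
  have h2 := ((hu.differentiable (by simp)) x).hasFDerivAt.sub
    ((hw.differentiable (by simp)) x).hasFDerivAt
  have h3 := h2.fderiv.symm.trans h1
  funext i
  exact congrArg (fun L => L (Pi.single i 1)) (sub_eq_zero.1 h3)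

/-- Along an orbit of `γ' = c + ∇u`, equality of the kinetic energies gives `(u - w)' = |∇u - ∇w|² /
2 ≥ 0`. On a closed orbit `u - w` is periodic, so it is constant and the gradients coincide. -/
lemma grad_eq_of_solvesHJ {W : UnitAddTorus (Fin d) → ℝ} {c : Fin d → ℝ}
    {u w : UnitAddTorus (Fin d) → ℝ} {a a' T : ℝ} {b : Fin d → ℤ} {γ : ℝ → Fin d → ℝ}
    (hu : ContDiff ℝ 1 (lift u)) (hw : ContDiff ℝ 1 (lift w)) (hsu : SolvesHJ W c u a)
    (hsw : SolvesHJ W c w a') (hT : T ≠ 0) (hγ : IsClosedOrbit c u T b γ) :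
    grad w (γ 0) = grad u (γ 0) := by
  have haa : a = a' := by
    obtain ⟨x, hx⟩ := exists_grad_eq hu hw
    rw [← hsu x, ← hsw x, hx]
  subst haa
  set g := fun t => lift u (γ t) - lift w (γ t) with hg
  have hd : ∀ t, HasDerivAt g (∑ i, (grad u (γ t) i - grad w (γ t) i) ^ 2 / 2) t := fun t => by
    refine ((hasDerivAt_lift_comp hu (hγ.hasDerivAt t)).sub
      (hasDerivAt_lift_comp hw (hγ.hasDerivAt t))).congr_deriv ?_
    have h1 := (hsu (γ t)).trans (hsw (γ t)).symm
    simp only [hamiltonian, add_left_inj] at h1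
    rw [← sub_eq_zero, ← Finset.sum_sub_distrib] at h1 ⊢
    rw [← Finset.sum_sub_distrib, ← h1]
    refine Finset.sum_congr rfl fun i _ => ?_
    simp only [Pi.add_apply]
    ring
  have hmono : Monotone g := monotone_of_deriv_nonneg (fun t => (hd t).differentiableAt)
    fun t => by
      rw [(hd t).deriv]
      exact Finset.sum_nonneg fun i _ => by positivity
  have hper : Function.Periodic g T := fun t => by
    simp only [hg, hγ.translation, lift_add_int]
  have hT' : 0 < |T| := abs_pos.2 hT
  have hper' : Function.Periodic g |T| := by
    rcases abs_choice T with h | h <;> rw [h]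
    · exact hper
    · exact hper.neg
  have hconst : ∀ t ∈ Set.Ioo (-|T|) |T|, g t = g 0 := fun t ht => by
    have h1 := hper' 0
    have h2 := hper'.neg 0
    rw [zero_add] at h1 h2
    exact le_antisymm (h1 ▸ hmono ht.2.le) (h2 ▸ hmono ht.1.le)
  have h0 : HasDerivAt g 0 0 := (hasDerivAt_const (0 : ℝ) (g 0)).congr_of_eventuallyEq <| by
    filter_upwards [Ioo_mem_nhds (neg_lt_zero.2 hT') hT'] with t ht using hconst t ht
  have h1 := (hd 0).unique h0
  rw [Finset.sum_eq_zero_iff_of_nonneg fun i _ => by positivity] at h1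
  funext i
  have h2 := h1 i (Finset.mem_univ i)
  have h3 : grad u (γ 0) i - grad w (γ 0) i = 0 := by
    refine pow_eq_zero_iff (two_ne_zero) |>.1 ?_
    linarith
  linarith

end Torus

/-! ### Averages of the perturbation over closed orbits -/

section Average

variable {d : ℕ} {V : Fin d → UnitAddCircle → ℝ} {μ c : Fin d → ℝ} {e : ℝ} {b : Fin d → ℤ}
  {U : UnitAddTorus (Fin d) → ℝ}

lemma grad_energyPotential (hV : ∀ i, IsProfile (lift₁ (V i))) (μ x : Fin d → ℝ) (i : Fin d) :
    grad (energyPotential V μ 0 0) x i = -(μ i * deriv (lift₁ (V i)) (x i)) := by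
  have h1 : ∀ j, HasFDerivAt (fun y : Fin d → ℝ => μ j * lift₁ (V j) (y j))
      (μ j • (deriv (lift₁ (V j)) (x j) • ContinuousLinearMap.proj (R := ℝ) j)) x := fun j =>
    (((hV j).hasDerivAt (x j)).comp_hasFDerivAt (f := fun y : Fin d → ℝ => y j) x
      (hasFDerivAt_apply (𝕜 := ℝ) j x)).const_mul (μ j)
  have h2 : HasFDerivAt (lift (energyPotential V μ 0 0))
      (-∑ j, μ j • (deriv (lift₁ (V j)) (x j) • ContinuousLinearMap.proj (R := ℝ) j)) x := by
    refine (HasFDerivAt.fun_sum fun j _ => h1 j).fun_neg.congr_of_eventuallyEq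
      (Eventually.of_forall fun y => ?_)
    simp [lift, lift₁, energyPotential, proj]
  rw [grad, h2.fderiv]
  simp [Pi.single_apply]

/-- Through every point of a torus whose rotation vector is a multiple of `b` there is a closed
orbit. -/
lemma HasRotationVector.exists_closedOrbit {W : UnitAddTorus (Fin d) → ℝ}
    {u : UnitAddTorus (Fin d) → ℝ} {r : ℝ} (hr : r ≠ 0)
    (h : HasRotationVector W c u fun i => r * (b i : ℝ)) (x : Fin d → ℝ) :
    ∃ γ, γ 0 = x ∧ IsClosedOrbit c u r⁻¹ b γ ∧ IsTrajectory W γ fun t => c + grad u (γ t) := by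
  obtain ⟨X, Y, -, -, -, hXY, hX, htr⟩ := h
  refine ⟨fun t => X (Y x + t • fun i => r * (b i : ℝ)), by simpa using hXY x,
    ⟨fun t => (htr (Y x) t).1, fun t => ?_⟩, htr (Y x)⟩
  rw [← hX]
  congr 1
  funext i
  simp only [Pi.add_apply, Pi.smul_apply, smul_eq_mul]
  field_simp
  ring

/-- Each component is a one-dimensional motion advancing by `b i` in time `T`. The content is that
its ratio `μ i / E i` is the explicit `level`, independent of `c`. -/
lemma angle_of_isClosedOrbit (hd : 0 < d) (hV : ∀ i, IsProfile (lift₁ (V i))) (he : 0 < e)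
    (hμ : ∀ i, 0 ≤ μ i) (hb : ∀ i, b i ≠ 0) {β : Fin d → ℝ} (hβ : ∀ i, 0 < β i)
    (hβb : ∀ i, β i = (b i : ℝ) ^ 2) {u : UnitAddTorus (Fin d) → ℝ}
    (hu : SolvesHJ (energyPotential V μ 0 0) c u e) {T : ℝ} (hT : T ≠ 0) {γ : ℝ → Fin d → ℝ}
    (hγ : IsClosedOrbit c u T b γ)
    (htr : IsTrajectory (energyPotential V μ 0 0) γ fun t => c + grad u (γ t)) (i : Fin d) (t : ℝ) :
    haveI : Nonempty (Fin d) := ⟨⟨0, hd⟩⟩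
    angle (lift₁ (V i)) (level hV μ he hβ i) (γ t i) =
      angle (lift₁ (V i)) (level hV μ he hβ i) (γ 0 i) + t * (b i / T) := by
  have : Nonempty (Fin d) := ⟨⟨0, hd⟩⟩
  have h1 : ∀ j, ∃ E, 0 < E ∧
      (∀ t, (c + grad u (γ t)) j ^ 2 / 2 - μ j * lift₁ (V j) (γ t j) = E) ∧
      2 * E * T ^ 2 = b j ^ 2 * mass (lift₁ (V j)) (μ j / E) ^ 2 ∧
      ∀ t, angle (lift₁ (V j)) (μ j / E) (γ t j) =
        angle (lift₁ (V j)) (μ j / E) (γ 0 j) + t * (b j / T) := fun j => by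
    refine exists_energy_of_translation (hV j) (hμ j)
      (q := fun t => γ t j) (p := fun t => (c + grad u (γ t)) j)
      (fun t => hasDerivAt_pi.1 (htr t).1 j) (fun t => ?_) (hb j) hT
      fun t => congrFun (hγ.translation t) j
    refine (hasDerivAt_pi.1 (htr t).2 j).congr_deriv ?_
    rw [Pi.neg_apply, grad_energyPotential hV, neg_neg]
  choose E hE0 hE hEm hEa using h1
  have hsum : ∑ j, E j = e := by
    rw [← hu (γ 0), hamiltonian, energyPotential]
    simp only [← hE _ 0, Finset.sum_sub_distrib, proj, lift₁, Pi.zero_apply, zero_mul, add_zero]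
    ring
  have hfreq : ∀ j, (hV j).freqIso.symm (2 * T ^ 2 * max (μ j) 0 / β j) = μ j / E j := fun j => by
    rw [OrderIso.symm_apply_eq, IsProfile.freqIso_apply, freqRatio, max_eq_left (hμ j), hβb]
    have h2 : (b j : ℝ) ≠ 0 := by exact_mod_cast hb j
    have h3 := (hE0 j).ne'
    have h4 : mass (lift₁ (V j)) (μ j / E j) ^ 2 = 2 * E j * T ^ 2 / b j ^ 2 := by
      rw [eq_div_iff (pow_ne_zero 2 h2), hEm j]; ring
    rw [h4]
    field_simp
  -- Summing `2 E_j T² = b_j² W_j²` over `j` with `∑ E_j = e` shows that `2T²` is the unique zero of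
  -- `scaleFun`.
  have hs : 2 * T ^ 2 = scale hV μ he hβ := by
    refine eq_scale hV μ he hβ ?_
    rw [scaleFun, sub_eq_zero, ← hsum, Finset.sum_mul]
    refine Finset.sum_congr rfl fun j _ => ?_
    rw [hfreq, hβb, ← hEm]
    ring
  have hlev : level hV μ he hβ i = μ i / E i := by rw [level, ← hs, hfreq]
  rw [hlev]
  exact hEa i t

/-- The averages of the perturbation over the closed orbits of the unperturbed torus agree. -/
lemma exists_average_eq (hd : 0 < d) (hV : ∀ i, IsProfile (lift₁ (V i))) (he : 0 < e)
    (hμ : ∀ i, 0 ≤ μ i) (hU : Continuous U) (hb : ∀ i, b i ≠ 0) {β : Fin d → ℝ}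
    (hβ : ∀ i, 0 < β i) (hβb : ∀ i, β i = (b i : ℝ) ^ 2) (hres : IsResonantTorus V μ e b c)
    {ε : ℕ → ℝ} (hpres : IsPreserved V μ U ε c) (hε : ∀ n, ε n ≠ 0)
    (hε0 : Tendsto ε atTop (𝓝 0)) :
    haveI : Nonempty (Fin d) := ⟨⟨0, hd⟩⟩
    ∃ a : ℝ, ∀ φ : Fin d → ℝ, ∫ s in (0 : ℝ)..1, U (proj fun i =>
      (angleIso (hV i).continuous (hV i).nonneg (hV i).periodic (level hV μ he hβ i)).symm
        (φ i + s * b i)) = a := by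
  have : Nonempty (Fin d) := ⟨⟨0, hd⟩⟩
  obtain ⟨-, u, hu, hsu, -, r, hr, hrot⟩ := hres
  obtain ⟨u₀, u₁, a₀, a₁, hu₀, hu₁, hs₀, hfirst⟩ := hpres.exists_first_order hε hε0
  refine ⟨a₁, fun φ => ?_⟩
  set Ψ := fun i =>
    angleIso (hV i).continuous (hV i).nonneg (hV i).periodic (level hV μ he hβ i) with hΨ
  set T := r⁻¹ with hT
  have hT0 : T ≠ 0 := inv_ne_zero hr
  obtain ⟨γ, hγ0, hγ, htr⟩ := hrot.exists_closedOrbit hr fun i => (Ψ i).symm (φ i)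
  have hγt : ∀ t i, (Ψ i).symm (φ i + t * (b i / T)) = γ t i := fun t i => by
    rw [OrderIso.symm_apply_eq]
    have h1 := angle_of_isClosedOrbit hd hV he hμ hb hβ hβb hsu hT0 hγ htr i t
    have h2 : angle (lift₁ (V i)) (level hV μ he hβ i) (γ 0 i) = φ i := by
      rw [hγ0]; exact (Ψ i).apply_symm_apply (φ i)
    rw [h2] at h1
    exact h1.symm
  have hγc : Continuous γ := continuous_iff_continuousAt.2 fun t => (hγ.hasDerivAt t).continuousAt
  have hUc : Continuous fun t => U (proj (γ t)) :=
    hU.comp (isOpenQuotientMap_proj.continuous.comp hγc)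
  -- The transport equation, with the gradient of `u₀` replaced by that of `u`. As `u₁` takes equal
  -- values at the ends of a closed orbit, integration gives the average `a₁`.
  have hd1 : ∀ t, HasDerivAt (fun t => lift u₁ (γ t)) (a₁ - U (proj (γ t))) t := fun t => by
    refine (hasDerivAt_lift_comp hu₁ (hγ.hasDerivAt t)).congr_deriv ?_
    have hshift : IsClosedOrbit c u T b fun s => γ (s + t) :=
      ⟨fun s => (hγ.hasDerivAt (s + t)).comp_add_const s t,
        fun s => by rw [add_right_comm]; exact hγ.translation _⟩
    have hgrad := grad_eq_of_solvesHJ hu.1 hu₀ hsu hs₀ hT0 hshift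
    simp only [zero_add] at hgrad
    rw [← hfirst (γ t), hgrad]
    ring
  have hint := intervalIntegral.integral_eq_sub_of_hasDerivAt (a := 0) (b := T)
    (fun t _ => hd1 t) ((continuous_const.sub hUc).intervalIntegrable _ _)
  have hend : lift u₁ (γ T) = lift u₁ (γ 0) := by
    have := hγ.translation 0
    rw [zero_add] at this
    rw [this, lift_add_int]
  rw [hend, sub_self, intervalIntegral.integral_sub intervalIntegrable_const
    (hUc.intervalIntegrable _ _), intervalIntegral.integral_const, sub_zero, smul_eq_mul] at hint
  have hsub := intervalIntegral.integral_comp_mul_right (a := 0) (b := 1)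
    (fun t => U (proj (γ t))) hT0
  rw [zero_mul, one_mul, smul_eq_mul] at hsub
  have hcongr : ∀ s : ℝ, (fun i => (Ψ i).symm (φ i + s * b i)) = γ (s * T) := fun s => by
    funext i
    rw [← hγt]
    congr 2
    field_simp
  change ∫ s in (0 : ℝ)..1, U (proj fun i => (Ψ i).symm (φ i + s * b i)) = a₁
  simp only [hcongr, hsub]
  rw [inv_mul_eq_div, div_eq_iff hT0]
  linarith

end Average

/-! ### Fourier coefficients in the angle variables -/

section Fourier

open scoped ContDiff

variable {v : ℝ → ℝ} (hv : IsProfile v) (l : ℝ)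

lemma periodic_coe_angleIso_symm : Function.Periodic (fun y : ℝ =>
    (((angleIso hv.continuous hv.nonneg hv.periodic l).symm y : ℝ) : UnitAddCircle)) 1 := fun y => by
  simp only [angleIso_symm_add_one]
  exact AddCircle.coe_add_period 1 _

/-- The inverse of the angle variable, as a map of the circle. -/
noncomputable def circleMap : UnitAddCircle → UnitAddCircle := (periodic_coe_angleIso_symm hv l).lift

lemma circleMap_coe (y : ℝ) : circleMap hv l (y : UnitAddCircle) =
    (((angleIso hv.continuous hv.nonneg hv.periodic l).symm y : ℝ) : UnitAddCircle) :=
  (periodic_coe_angleIso_symm hv l).lift_coe y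

lemma continuous_circleMap : Continuous (circleMap hv l) := by
  refine QuotientAddGroup.isOpenQuotientMap_mk.continuous_comp_iff.1 ?_
  refine ((AddCircle.continuous_mk' 1).comp
    (angleIso hv.continuous hv.nonneg hv.periodic l).symm.continuous).congr fun y => ?_
  exact (circleMap_coe hv l y).symm

lemma integral_fourier_circleMap (k m : ℤ) :
    ∫ θ : UnitAddCircle, fourier k (circleMap hv l θ) * fourier (-m) θ = modeCoeff v l k m := by
  rw [← UnitAddCircle.intervalIntegral_preimage 0, zero_add,
    modeCoeff_eq_integral_symm hv.continuous hv.nonneg hv.periodic]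
  refine intervalIntegral.integral_congr fun y _ => ?_
  simp only [circleMap_coe, fourier_coe_apply, ← Complex.exp_add]
  congr 1
  push_cast
  ring

variable {d : ℕ} {V : Fin d → ℝ → ℝ} (hV : ∀ i, IsProfile (V i)) (L : Fin d → ℝ)

/-- The inverse of the angle variables, as a map of the torus. -/
noncomputable def torusMap (φ : UnitAddTorus (Fin d)) : UnitAddTorus (Fin d) :=
  fun i => circleMap (hV i) (L i) (φ i)

lemma continuous_torusMap : Continuous (torusMap hV L) :=
  continuous_pi fun i => (continuous_circleMap (hV i) (L i)).comp (continuous_apply i)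

lemma integral_mFourier_torusMap (k m : Fin d → ℤ) :
    ∫ φ : UnitAddTorus (Fin d), UnitAddTorus.mFourier k (torusMap hV L φ) *
      UnitAddTorus.mFourier (-m) φ = ∏ i, modeCoeff (V i) (L i) (k i) (m i) := by
  rw [← Finset.prod_congr rfl fun i _ => integral_fourier_circleMap (hV i) (L i) (k i) (m i),
    ← integral_fintype_prod_volume_eq_prod]
  refine integral_congr_ae (Eventually.of_forall fun φ => ?_)
  simp only [UnitAddTorus.mFourier, ContinuousMap.coe_mk, torusMap, Pi.neg_apply,
    ← Finset.prod_mul_distrib]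

lemma integral_mFourier_neg {m : Fin d → ℤ} (hm : m ≠ 0) :
    ∫ φ : UnitAddTorus (Fin d), UnitAddTorus.mFourier (-m) φ = 0 := by
  obtain ⟨i, hi⟩ := Function.ne_iff.1 hm
  have hprof : IsProfile fun _ : ℝ => (0 : ℝ) :=
    ⟨contDiff_const, fun _ => rfl, fun _ => le_rfl, 0, rfl⟩
  -- The zero potential and the constant mode `k = 0` reduce the integral to known mode
  -- coefficients.
  have h := integral_mFourier_torusMap (fun _ : Fin d => hprof) 0 0 m
  simp only [UnitAddTorus.mFourier_zero, ContinuousMap.one_apply, one_mul] at h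
  rw [h]
  refine Finset.prod_eq_zero (Finset.mem_univ i) ?_
  exact (modeCoeff_zero_left hprof.continuous hprof.nonneg 0 (m i)).trans (if_neg hi)

lemma mFourier_proj_smul {m b : Fin d → ℤ} (hmb : ∑ i, b i * m i = 0) (s : ℝ) :
    UnitAddTorus.mFourier (-m) (proj fun i => s * (b i : ℝ)) = 1 := by
  simp only [UnitAddTorus.mFourier, ContinuousMap.coe_mk, proj, fourier_coe_apply,
    ← Complex.exp_sum]
  rw [← Complex.exp_zero]
  congr 1
  have h : ((∑ i, b i * m i : ℤ) : ℂ) = 0 := by rw [hmb]; simp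
  push_cast at h
  calc _ = -(2 * Real.pi * Complex.I * s) * ∑ i, (b i : ℂ) * m i := by
        rw [Finset.mul_sum]
        refine Finset.sum_congr rfl fun i _ => ?_
        push_cast [Pi.neg_apply]
        ring
    _ = 0 := by rw [h, mul_zero]

lemma mFourier_apply_add (k : Fin d → ℤ) (x y : UnitAddTorus (Fin d)) :
    UnitAddTorus.mFourier k (x + y) =
      UnitAddTorus.mFourier k x * UnitAddTorus.mFourier k y := by
  simp only [UnitAddTorus.mFourier, ContinuousMap.coe_mk, Pi.add_apply, fourier_apply,
    smul_add, AddCircle.toCircle_add, Circle.coe_mul, ← Finset.prod_mul_distrib]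

/-- Translation along `b` preserves Haar measure and the mode `m ⟂ b`. Averaging over these
translations replaces `g` by the constant `a`, and a non-zero mode has integral zero. -/
lemma integral_mul_mFourier_eq_zero {g : UnitAddTorus (Fin d) → ℂ} (hg : Continuous g)
    {m b : Fin d → ℤ} (hmb : ∑ i, b i * m i = 0) (hm : m ≠ 0) {a : ℂ}
    (ha : ∀ φ, ∫ s in (0 : ℝ)..1, g (φ + proj fun i => s * (b i : ℝ)) = a) :
    ∫ φ, g φ * UnitAddTorus.mFourier (-m) φ = 0 := by
  set F : ℝ → UnitAddTorus (Fin d) → ℂ := fun s φ =>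
    g (φ + proj fun i => s * (b i : ℝ)) * UnitAddTorus.mFourier (-m) φ with hF
  have hs : ∀ s : ℝ, ∫ φ, F s φ = ∫ φ, g φ * UnitAddTorus.mFourier (-m) φ := fun s => by
    rw [← integral_add_right_eq_self (fun φ => g φ * UnitAddTorus.mFourier (-m) φ)
      (proj fun i => s * (b i : ℝ))]
    simp only [hF, mFourier_apply_add, mFourier_proj_smul hmb, mul_one]
  have hFc : Continuous (Function.uncurry F) := by
    have h1 : Continuous fun s : ℝ => (proj fun i => s * (b i : ℝ) : UnitAddTorus (Fin d)) :=
      isOpenQuotientMap_proj.continuous.comp (by fun_prop)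
    have h2 := (UnitAddTorus.mFourier (-m)).continuous
    exact (hg.comp (continuous_snd.add (h1.comp continuous_fst))).mul (h2.comp continuous_snd)
  obtain ⟨C, hC⟩ := isCompact_univ.exists_bound_of_continuousOn hg.continuousOn
  have : IsFiniteMeasure (volume.restrict (Set.uIoc (0 : ℝ) 1)) := ⟨by simp [Set.uIoc]⟩
  have hint : Integrable (Function.uncurry F)
      ((volume.restrict (Set.uIoc (0 : ℝ) 1)).prod volume) := by
    refine Integrable.of_bound hFc.aestronglyMeasurable C (Eventually.of_forall fun z => ?_)
    simp only [Function.uncurry_def, hF, norm_mul]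
    have h1 : ‖UnitAddTorus.mFourier (-m) z.2‖ ≤ 1 :=
      (ContinuousMap.norm_coe_le_norm _ _).trans_eq UnitAddTorus.mFourier_norm
    calc _ ≤ ‖g (z.2 + proj fun i => z.1 * (b i : ℝ))‖ * 1 := by gcongr
      _ ≤ C := by rw [mul_one]; exact hC _ (Set.mem_univ _)
  have hswap := intervalIntegral_integral_swap hint
  simp only [hs, intervalIntegral.integral_const, sub_zero, one_smul] at hswap
  rw [hswap]
  simp only [hF, intervalIntegral.integral_mul_const, ha, integral_const_mul,
    integral_mFourier_neg hm, mul_zero]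

variable {U : UnitAddTorus (Fin d) → ℝ}

lemma IsPerturbation.continuous (hU : IsPerturbation U) : Continuous U :=
  continuous_of_continuous_lift hU.contDiff.continuous

lemma IsPerturbation.hasSum (hU : IsPerturbation U) (x : UnitAddTorus (Fin d)) :
    HasSum (fun k => UnitAddTorus.mFourierCoeff (fun x => (U x : ℂ)) k *
      UnitAddTorus.mFourier k x) (U x : ℂ) :=
  UnitAddTorus.hasSum_mFourier_series_apply_of_summable
    (f := ⟨fun x => (U x : ℂ), Complex.continuous_ofReal.comp hU.continuous⟩)
    hU.summable.of_norm x

/-- If the averages of `U` along the direction `b` in the angle variables agree, then its Fourier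
coefficients in the angle variables vanish on the resonant modes. -/
lemma IsPerturbation.hasSum_prod_modeCoeff (hU : IsPerturbation U) {m b : Fin d → ℤ}
    (hmb : ∑ i, b i * m i = 0) (hm : m ≠ 0) {a : ℝ}
    (ha : ∀ φ : Fin d → ℝ, ∫ s in (0 : ℝ)..1, U (proj fun i =>
      (angleIso (hV i).continuous (hV i).nonneg (hV i).periodic (L i)).symm
        (φ i + s * b i)) = a) :
    HasSum (fun k => UnitAddTorus.mFourierCoeff (fun x => (U x : ℂ)) k *
      ∏ i, modeCoeff (V i) (L i) (k i) (m i)) 0 := by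
  set c := UnitAddTorus.mFourierCoeff fun x => (U x : ℂ) with hc
  have hT := continuous_torusMap hV L
  have hzero : ∫ φ, (U (torusMap hV L φ) : ℂ) * UnitAddTorus.mFourier (-m) φ = 0 := by
    refine integral_mul_mFourier_eq_zero
      (Complex.continuous_ofReal.comp (hU.continuous.comp hT)) hmb hm (a := a) fun φ => ?_
    obtain ⟨y, rfl⟩ := isOpenQuotientMap_proj.surjective φ
    rw [← ha y, ← intervalIntegral.integral_ofReal]
    refine intervalIntegral.integral_congr fun s _ => ?_
    refine congrArg (fun z => ((U z : ℝ) : ℂ)) ?_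
    funext i
    simp only [torusMap, Pi.add_apply, proj, ← AddCircle.coe_add, circleMap_coe]
  have hterm : ∀ k φ, ‖c k * (UnitAddTorus.mFourier k (torusMap hV L φ) *
      UnitAddTorus.mFourier (-m) φ)‖ ≤ ‖c k‖ := fun k φ => by
    have h1 : ∀ (n : Fin d → ℤ) x, ‖UnitAddTorus.mFourier n x‖ ≤ 1 := fun n x =>
      (ContinuousMap.norm_coe_le_norm _ _).trans_eq UnitAddTorus.mFourier_norm
    rw [norm_mul, norm_mul]
    exact mul_le_of_le_one_right (norm_nonneg _)
      (mul_le_one₀ (h1 _ _) (norm_nonneg _) (h1 _ _))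
  have hcont : ∀ k, Continuous fun φ => c k * (UnitAddTorus.mFourier k (torusMap hV L φ) *
      UnitAddTorus.mFourier (-m) φ) := fun k => by
    have h1 := (UnitAddTorus.mFourier (-m)).continuous
    have h2 := (UnitAddTorus.mFourier k).continuous.comp hT
    exact continuous_const.mul (h2.mul h1)
  have hint : ∀ k, Integrable fun φ => c k * (UnitAddTorus.mFourier k (torusMap hV L φ) *
      UnitAddTorus.mFourier (-m) φ) := fun k =>
    Integrable.of_bound (hcont k).aestronglyMeasurable ‖c k‖ (Eventually.of_forall (hterm k))
  -- Absolute convergence of the Fourier series justifies integration term by term after the change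
  -- of variables.
  have hsum := hasSum_integral_of_summable_integral_norm hint
    (hU.summable.of_nonneg_of_le (fun k => integral_nonneg fun φ => norm_nonneg _) fun k => by
      have h1 := integral_mono (hint k).norm (integrable_const ‖c k‖) (hterm k)
      have hvol : volume.real (Set.univ : Set (UnitAddTorus (Fin d))) = 1 := by
        have : IsProbabilityMeasure (volume : Measure UnitAddCircle) :=
          ⟨UnitAddCircle.measure_univ⟩
        exact probReal_univ
      rwa [integral_const, hvol, one_smul] at h1)
  have htsum : ∀ φ, ∑' k, c k * (UnitAddTorus.mFourier k (torusMap hV L φ) *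
      UnitAddTorus.mFourier (-m) φ) =
      (U (torusMap hV L φ) : ℂ) * UnitAddTorus.mFourier (-m) φ := fun φ => by
    simp only [← mul_assoc]
    exact ((hU.hasSum _).mul_right _).tsum_eq
  simp only [htsum, hzero, integral_const_mul, integral_mFourier_torusMap] at hsum
  exact hsum

end Fourier

/-! ### Null sets from analyticity along rays -/

section NullSet

lemma ae_ne_zero_of_analyticAt {f : ℝ → ℂ} (hf : ∀ t, 0 < t → AnalyticAt ℝ f t) {t₁ : ℝ}
    (ht₁ : 0 < t₁) (h : f t₁ ≠ 0) : ∀ᵐ t ∂volume.restrict (Set.Ioi (0 : ℝ)), f t ≠ 0 := by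
  have hf' : AnalyticOnNhd ℝ f (Set.Ioi 0) := fun t ht => hf t ht
  refine ae_restrict_le_codiscreteWithin measurableSet_Ioi ?_
  exact (hf'.eqOn_zero_or_eventually_ne_zero_of_preconnected isPreconnected_Ioi).resolve_left
    fun h0 => h (h0 ht₁)

/-- A measurable set that meets every ray from the origin in a null set is a null set. -/
lemma volume_eq_zero_of_rays {ι : Type*} [Fintype ι] {Z : Set (ι → ℝ)} (hZ : MeasurableSet Z)
    (h : ∀ x : ι → ℝ, ∀ᵐ t ∂volume.restrict (Set.Ioi (0 : ℝ)), t • x ∉ Z) : volume Z = 0 := by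
  have hm : Measurable fun z : (ι → ℝ) × ℝ => z.2 • z.1 := measurable_snd.smul measurable_fst
  have h1 : ∀ᵐ t ∂volume.restrict (Set.Ioi (0 : ℝ)), ∀ᵐ x : ι → ℝ, t • x ∉ Z :=
    (Measure.ae_ae_comm (p := fun (x : ι → ℝ) (t : ℝ) => t • x ∉ Z)
      (hm hZ.compl)).1 (Eventually.of_forall h)
  have hne : NeBot (ae (volume.restrict (Set.Ioi (0 : ℝ)))) := by
    rw [ae_neBot, Ne, Measure.restrict_eq_zero, Real.volume_Ioi]
    exact ENNReal.top_ne_zero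
  -- By Fubini some single dilate of `Z` is null; dilations scale Lebesgue measure, so `Z` is null
  -- too.
  obtain ⟨t, ht, ht0⟩ := (h1.and (ae_restrict_mem measurableSet_Ioi)).exists
  have h2 : volume ((t • ·) ⁻¹' Z : Set (ι → ℝ)) = 0 := by
    simpa [ae_iff, Set.preimage] using ht
  have ht0' : t ≠ 0 := ne_of_gt ht0
  rw [Measure.addHaar_preimage_smul _ ht0'] at h2
  refine (mul_eq_zero.1 h2).resolve_left ?_
  simp [ht0']

end NullSet

/-! ### Perturbation of products and of the identity matrix -/

section Products

lemma norm_prod_sub_prod_le_sum {ι : Type*} (s : Finset ι) (f g : ι → ℂ)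
    (hf : ∀ i ∈ s, ‖f i‖ ≤ 1) (hg : ∀ i ∈ s, ‖g i‖ ≤ 1) :
    ‖∏ i ∈ s, f i - ∏ i ∈ s, g i‖ ≤ ∑ i ∈ s, ‖f i - g i‖ := by
  classical
  induction s using Finset.induction_on with
  | empty => simp
  | insert a s ha ih =>
    rw [Finset.prod_insert ha, Finset.prod_insert ha, Finset.sum_insert ha]
    have ih' := ih (fun i hi => hf i (Finset.mem_insert_of_mem hi))
      fun i hi => hg i (Finset.mem_insert_of_mem hi)
    have h1 : ‖∏ i ∈ s, f i‖ ≤ 1 := by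
      rw [norm_prod]
      exact Finset.prod_le_one (fun i _ => norm_nonneg _)
        fun i hi => hf i (Finset.mem_insert_of_mem hi)
    have h2 := hg a (Finset.mem_insert_self a s)
    calc ‖f a * ∏ i ∈ s, f i - g a * ∏ i ∈ s, g i‖
        = ‖(f a - g a) * ∏ i ∈ s, f i + g a * (∏ i ∈ s, f i - ∏ i ∈ s, g i)‖ := by
          congr 1; ring
      _ ≤ ‖f a - g a‖ * ‖∏ i ∈ s, f i‖ + ‖g a‖ * ‖∏ i ∈ s, f i - ∏ i ∈ s, g i‖ := by
          refine (norm_add_le _ _).trans_eq ?_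
          rw [norm_mul, norm_mul]
      _ ≤ ‖f a - g a‖ * 1 + 1 * ∑ i ∈ s, ‖f i - g i‖ := by gcongr
      _ = _ := by ring

/-- A matrix close to the identity is invertible. -/
lemma det_ne_zero_of_norm_sub_one_le {n : Type*} [Fintype n] [DecidableEq n] (M : Matrix n n ℂ)
    {θ : ℝ} (hθ : Fintype.card n * θ < 1)
    (h : ∀ i j, ‖M i j - (1 : Matrix n n ℂ) i j‖ ≤ θ) : M.det ≠ 0 := by
  refine det_ne_zero_of_sum_row_lt_diag fun k => ?_
  have h1 : ∀ j ∈ Finset.univ.erase k, ‖M k j‖ ≤ θ := fun j hj => by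
    have := h k j
    rwa [Matrix.one_apply_ne (Finset.ne_of_mem_erase hj).symm, sub_zero] at this
  have h2 := Finset.sum_le_card_nsmul _ _ _ h1
  have h3 := h k k
  rw [Matrix.one_apply_eq] at h3
  have h4 : 1 - θ ≤ ‖M k k‖ := by
    have h5 := norm_sub_norm_le (1 : ℂ) (M k k)
    rw [norm_one, norm_sub_rev] at h5
    linarith
  have hpos : 1 ≤ Fintype.card n := Fintype.card_pos_iff.2 ⟨k⟩
  rw [Finset.card_erase_of_mem (Finset.mem_univ k), Finset.card_univ, nsmul_eq_mul,
    Nat.cast_sub hpos, Nat.cast_one] at h2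
  linarith

end Products

/-! ### Resonances with comparable entries -/

section Resonance

variable {d : ℕ}

/-- An integer vector with at least two non-zero entries is orthogonal to a primitive integer vector
without zero entries, whose entries at the bounded places are comparable to its norm. -/
lemma exists_resonance {k : Fin d → ℤ} (hk : ∃ i j, i ≠ j ∧ k i ≠ 0 ∧ k j ≠ 0) {D : ℕ}
    {S : Set (Fin d)} (hS : ∀ i ∈ S, |k i| ≤ D) :
    ∃ b : Fin d → ℤ, Finset.univ.gcd b = 1 ∧ (∀ i, b i ≠ 0) ∧ ∑ i, b i * k i = 0 ∧
      ∀ i ∈ S, ∑ j, b j ^ 2 ≤ (4 * d ^ 3 * (D + 1) ^ 2 : ℕ) * b i ^ 2 := by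
  obtain ⟨i₁, i₂, hne, h1, h2⟩ := hk
  have : Nonempty (Fin d) := ⟨i₁⟩
  obtain ⟨f, hf⟩ := Finite.exists_max fun i => |k i|
  have hkf : 1 ≤ |k f| := le_trans (Int.one_le_abs h1) (hf i₁)
  have hkf0 : k f ≠ 0 := fun h => by simp [h] at hkf
  obtain ⟨g, hgf, hg⟩ : ∃ g, g ≠ f ∧ k g ≠ 0 := by
    by_cases h : i₁ = f
    · exact ⟨i₂, fun h' => hne (h.trans h'.symm), h2⟩
    · exact ⟨i₁, h, h1⟩
  have hd1 : (1 : ℤ) ≤ d := by exact_mod_cast (Fin.pos f)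
  set R := ∑ j ∈ Finset.univ.erase f, k j with hR
  -- The weights `a j` are all `1`, except for weight `2` at `g` when the plain sum `R` vanishes;
  -- this makes the entry of `b` at `f` non-zero.
  obtain ⟨y, hy, hyR⟩ : ∃ y : ℤ, (y = 0 ∨ y = 1) ∧ R + y * k g ≠ 0 := by
    by_cases h : R = 0
    · exact ⟨1, Or.inr rfl, by rw [h]; simpa using hg⟩
    · exact ⟨0, Or.inl rfl, by simpa using h⟩
  set a : Fin d → ℤ := fun j => 1 + y * (if j = g then 1 else 0) with ha
  have ha1 : ∀ j, 1 ≤ a j ∧ a j ≤ 2 := fun j => by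
    simp only [ha]
    rcases hy with rfl | rfl <;> split_ifs <;> norm_num
  have hsum : ∑ j ∈ Finset.univ.erase f, a j * k j = R + y * k g := by
    simp only [ha, add_mul, one_mul, Finset.sum_add_distrib, hR]
    congr 1
    rw [Finset.sum_eq_single g]
    · simp
    · intro j _ hj; simp [hj]
    · intro h; exact absurd (Finset.mem_erase.2 ⟨hgf, Finset.mem_univ _⟩) h
  -- The entry at `f` is determined by orthogonality to `k`. As `|k f|` is maximal, every `|b j|` is
  -- at most `2d |k f|`.
  set b : Fin d → ℤ := fun j => if j = f then -(R + y * k g) else a j * k f with hb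
  have hbf : b f = -(R + y * k g) := by simp [hb]
  have hbj : ∀ j, j ≠ f → b j = a j * k f := fun j hj => by simp [hb, hj]
  have hb0 : ∀ j, b j ≠ 0 := fun j => by
    by_cases hj : j = f
    · rw [hj, hbf]; exact neg_ne_zero.2 hyR
    · rw [hbj j hj]; exact mul_ne_zero (by have := (ha1 j).1; omega) hkf0
  have hborth : ∑ j, b j * k j = 0 := by
    have hE : ∑ j ∈ Finset.univ.erase f, b j * k j =
        (∑ j ∈ Finset.univ.erase f, a j * k j) * k f := by
      rw [Finset.sum_mul]
      refine Finset.sum_congr rfl fun j hj => ?_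
      rw [hbj j (Finset.ne_of_mem_erase hj)]
      ring
    rw [← Finset.add_sum_erase _ _ (Finset.mem_univ f), hbf, hE, hsum]
    ring
  have hble : ∀ j, |b j| ≤ 2 * d * |k f| := fun j => by
    by_cases hj : j = f
    · rw [hj, hbf, abs_neg, ← hsum]
      calc |∑ j ∈ Finset.univ.erase f, a j * k j|
          ≤ ∑ j ∈ Finset.univ.erase f, |a j * k j| := Finset.abs_sum_le_sum_abs _ _
        _ ≤ ∑ j, |a j * k j| := Finset.sum_le_sum_of_subset_of_nonneg (Finset.erase_subset _ _)
            fun _ _ _ => abs_nonneg _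
        _ ≤ ∑ _j : Fin d, 2 * |k f| := Finset.sum_le_sum fun j _ => by
            rw [abs_mul, abs_of_nonneg (by linarith [(ha1 j).1])]
            exact mul_le_mul (ha1 j).2 (hf j) (abs_nonneg _) (by norm_num)
        _ = 2 * d * |k f| := by simp; ring
    · rw [hbj j hj, abs_mul, abs_of_nonneg (by linarith [(ha1 j).1])]
      have := (ha1 j).2
      have h3 := abs_nonneg (k f)
      nlinarith [mul_nonneg (by linarith : (0 : ℤ) ≤ d - 1) h3]
  have hsq : ∑ j, b j ^ 2 ≤ 4 * d ^ 3 * k f ^ 2 := by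
    calc ∑ j, b j ^ 2 ≤ ∑ _j : Fin d, (2 * d * |k f|) ^ 2 := Finset.sum_le_sum fun j _ => by
          rw [← sq_abs (b j)]
          exact pow_le_pow_left₀ (abs_nonneg _) (hble j) 2
      _ = 4 * d ^ 3 * k f ^ 2 := by
          rw [Finset.sum_const, Finset.card_univ, Fintype.card_fin, nsmul_eq_mul, mul_pow, sq_abs]
          ring
  -- For `i ≠ f` the entry `b i` is at least `|k f|` in size. For `i = f ∈ S` only `|b i| ≥ 1` is
  -- known, but then `|k f| ≤ D`.
  have hcomp : ∀ i ∈ S, ∑ j, b j ^ 2 ≤ (4 * d ^ 3 * (D + 1) ^ 2 : ℕ) * b i ^ 2 := fun i hi => by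
    refine hsq.trans ?_
    push_cast
    rw [mul_assoc (4 * (d : ℤ) ^ 3)]
    refine mul_le_mul_of_nonneg_left ?_ (by positivity)
    by_cases hj : i = f
    · have h3 : 1 ≤ b i ^ 2 := by
        have := Int.one_le_abs (hb0 i)
        rw [← sq_abs]; nlinarith
      have h4 : k f ^ 2 ≤ ((D : ℤ) + 1) ^ 2 := by
        rw [← sq_abs]
        refine pow_le_pow_left₀ (abs_nonneg _) ?_ 2
        have := hS i hi
        rw [hj] at this
        linarith
      nlinarith [sq_nonneg ((D : ℤ) + 1)]
    · rw [hbj i hj, mul_pow]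
      have h3 : (1 : ℤ) ≤ a i ^ 2 := by have := (ha1 i).1; nlinarith
      have h4 : (1 : ℤ) ≤ ((D : ℤ) + 1) ^ 2 := by
        have : (0 : ℤ) ≤ D := Int.natCast_nonneg D
        nlinarith
      have h5 : (1 : ℤ) ≤ ((D : ℤ) + 1) ^ 2 * a i ^ 2 := by nlinarith
      rw [← mul_assoc]
      exact le_mul_of_one_le_left (sq_nonneg _) h5
  -- The comparison is homogeneous, so dividing by the gcd preserves it.
  obtain ⟨c, hc, hc1⟩ := Finset.extract_gcd b (Finset.univ_nonempty (α := Fin d))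
  set G := Finset.univ.gcd b with hG
  have hc' : ∀ j, b j = G * c j := fun j => hc j (Finset.mem_univ j)
  have hG0 : G ≠ 0 := fun h => hb0 f (by rw [hc', h, zero_mul])
  refine ⟨c, hc1, fun j h => hb0 j (by rw [hc', h, mul_zero]), ?_, fun i hi => ?_⟩
  · simp only [hc', mul_assoc, ← Finset.mul_sum] at hborth
    exact (mul_eq_zero.1 hborth).resolve_left hG0
  · have h3 := hcomp i hi
    simp only [hc', mul_pow, ← Finset.mul_sum] at h3
    have h4 : 0 < G ^ 2 := by positivity
    refine le_of_mul_le_mul_left ?_ h4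
    linarith

end Resonance

/-! ### Spectrum on the coordinate axes -/

section Separable

variable {d : ℕ} {U : UnitAddTorus (Fin d) → ℝ}

lemma mFourier_apply (k : Fin d → ℤ) (x : UnitAddTorus (Fin d)) :
    UnitAddTorus.mFourier k x = ∏ i, fourier (k i) (x i) := rfl

lemma mFourier_eq_of_support (k : Fin d → ℤ) (hk : ∀ i j, k i ≠ 0 → k j ≠ 0 → i = j)
    (x : UnitAddTorus (Fin d)) :
    UnitAddTorus.mFourier k x =
      ∑ i, UnitAddTorus.mFourier k (Function.update 0 i (x i)) - ((d : ℂ) - 1) := by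
  have hone : ∀ y : UnitAddTorus (Fin d), (∀ i, k i ≠ 0 → y i = 0) →
      UnitAddTorus.mFourier k y = 1 := fun y hy => by
    rw [mFourier_apply]
    refine Finset.prod_eq_one fun i _ => ?_
    by_cases h : k i = 0
    · rw [h, fourier_zero]
    · rw [hy i h, fourier_eval_zero]
  have hupd : ∀ i, (∀ j, j ≠ i → k j = 0) →
      UnitAddTorus.mFourier k (Function.update 0 i (x i)) = UnitAddTorus.mFourier k x :=
    fun i hi => by
      rw [mFourier_apply, mFourier_apply]
      refine Finset.prod_congr rfl fun j _ => ?_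
      by_cases h : j = i
      · subst h; simp
      · rw [hi j h, fourier_zero, fourier_zero]
  by_cases h : ∃ i, k i ≠ 0
  · obtain ⟨i, hi⟩ := h
    rw [← Finset.add_sum_erase _ _ (Finset.mem_univ i), hupd i fun j hj => by
      by_contra hkj
      exact hj (hk j i hkj hi), Finset.sum_congr rfl fun j hj => hone _ fun l hl => ?_]
    · rw [Finset.sum_const, Finset.card_erase_of_mem (Finset.mem_univ i), Finset.card_univ,
        Fintype.card_fin, nsmul_eq_mul, Nat.cast_sub (Fin.pos i)]
      simp
    · rw [hk l i hl hi, Function.update_of_ne (Finset.ne_of_mem_erase hj).symm, Pi.zero_apply]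
  · push Not at h
    have hk0 : ∀ y, UnitAddTorus.mFourier k y = 1 := fun y => hone y fun i hi => absurd (h i) hi
    simp [hk0]

/-- A potential whose spectrum lies on the coordinate axes is separable. -/
lemma IsPerturbation.isSeparable (hd : 0 < d) (hU : IsPerturbation U)
    (h : ∀ k ∈ spectrumSet U, ∀ i j, k i ≠ 0 → k j ≠ 0 → i = j) : IsSeparable U := by
  -- For modes on the axes `U(x) = ∑ U(0,…,x_i,…,0) - (d - 1) U(0)`; the constant is shared equally
  -- among the summands.
  refine ⟨fun i t => U (Function.update 0 i t) - ((d : ℝ) - 1) / d * U 0, fun i => ?_, fun x => ?_⟩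
  · have h1 : lift₁ (fun t => U (Function.update 0 i t) - ((d : ℝ) - 1) / d * U 0) =
        fun t : ℝ => lift U (Pi.single i t) - ((d : ℝ) - 1) / d * U 0 := by
      funext t
      simp only [lift₁, lift]
      congr 2
      funext j
      by_cases hj : j = i
      · subst hj; simp [proj]
      · simp [proj, hj]
    rw [h1]
    refine (hU.contDiff.comp ?_).sub contDiff_const
    exact contDiff_pi.2 fun j => by
      by_cases hj : j = i
      · subst hj; simpa using contDiff_fun_id
      · simpa [hj] using contDiff_const
  · set c := UnitAddTorus.mFourierCoeff fun x => (U x : ℂ) with hc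
    have h1 := hU.hasSum x
    have h2 := (hasSum_sum (s := Finset.univ)
      fun i _ => hU.hasSum (Function.update 0 i (x i))).sub ((hU.hasSum 0).mul_left ((d : ℂ) - 1))
    have h3 := h1.unique (h2.congr_fun fun k => ?_)
    · have hd' : (d : ℝ) ≠ 0 := by exact_mod_cast hd.ne'
      have h4 : U x = ∑ i, U (Function.update 0 i (x i)) - ((d : ℝ) - 1) * U 0 := by
        exact_mod_cast h3
      rw [h4, Finset.sum_sub_distrib]
      simp only [Finset.sum_const, Finset.card_univ, Fintype.card_fin, nsmul_eq_mul]
      field_simp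
    · by_cases hck : c k = 0
      · simp [hc ▸ hck]
      · have h4 := mFourier_eq_of_support k (h k hck) x
        have h5 : UnitAddTorus.mFourier k (0 : UnitAddTorus (Fin d)) = 1 := by
          rw [mFourier_apply]
          exact Finset.prod_eq_one fun i _ => fourier_eval_zero _
        rw [h4, h5, ← Finset.mul_sum]
        ring

end Separable

/-! ### The finite sets of coupled modes -/

section Fiber

variable {d : ℕ}

open Classical in
/-- The elements of the spectrum with at least two non-zero entries, whose entries in `S` are
bounded by `D` and whose other entries are those of `k₀`. -/
noncomputable def fiber (U : UnitAddTorus (Fin d) → ℝ) (D : ℕ) (S : Set (Fin d))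
    (k₀ : Fin d → ℤ) : Finset (Fin d → ℤ) :=
  (Fintype.piFinset fun i => if i ∈ S then Finset.Icc (-(D : ℤ)) D else {k₀ i}).filter fun k =>
    k ∈ spectrumSet U ∧ ∃ i j, i ≠ j ∧ k i ≠ 0 ∧ k j ≠ 0

variable {U : UnitAddTorus (Fin d) → ℝ} {D : ℕ} {S : Set (Fin d)} {k₀ k : Fin d → ℤ}

lemma mem_fiber : k ∈ fiber U D S k₀ ↔ (∀ i ∈ S, |k i| ≤ D) ∧ (∀ i ∉ S, k i = k₀ i) ∧
    k ∈ spectrumSet U ∧ ∃ i j, i ≠ j ∧ k i ≠ 0 ∧ k j ≠ 0 := by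
  classical
  have h : (∀ i, k i ∈ if i ∈ S then Finset.Icc (-(D : ℤ)) D else {k₀ i}) ↔
      (∀ i ∈ S, |k i| ≤ D) ∧ ∀ i ∉ S, k i = k₀ i := by
    refine ⟨fun h => ⟨fun i hi => ?_, fun i hi => ?_⟩, fun h i => ?_⟩
    · have := h i
      rw [if_pos hi, Finset.mem_Icc] at this
      exact abs_le.2 this
    · have := h i
      rwa [if_neg hi, Finset.mem_singleton] at this
    · by_cases hi : i ∈ S
      · rw [if_pos hi, Finset.mem_Icc]; exact abs_le.1 (h.1 i hi)
      · rw [if_neg hi, Finset.mem_singleton]; exact h.2 i hi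
  rw [fiber, Finset.mem_filter, Fintype.mem_piFinset, h, and_assoc]

lemma card_fiber_le : (fiber U D S k₀).card ≤ (2 * D + 1) ^ d := by
  classical
  refine (Finset.card_filter_le _ _).trans ?_
  rw [Fintype.card_piFinset]
  calc _ ≤ ∏ _i : Fin d, (2 * D + 1) := Finset.prod_le_prod' fun i _ => by
        split_ifs
        · rw [Int.card_Icc]; omega
        · simp
    _ = (2 * D + 1) ^ d := by simp

end Fiber

/-! ### The linear systems and their determinants -/

section ResonanceMatrix

variable {d : ℕ}

lemma sq_cast_pos {b : Fin d → ℤ} (hb : ∀ i, b i ≠ 0) (i : Fin d) : 0 < ((b i : ℝ)) ^ 2 := by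
  have : (b i : ℝ) ≠ 0 := by exact_mod_cast hb i
  positivity

variable [Nonempty (Fin d)] {v : Fin d → ℝ → ℝ} (hv : ∀ i, IsProfile (v i)) {e : ℝ} (he : 0 < e)
  {B : (Fin d → ℤ) → Fin d → ℤ} (hB : ∀ k i, B k i ≠ 0) (s : Finset (Fin d → ℤ))
  (μ : Fin d → ℝ)

/-- The linear system for the Fourier coefficients of the perturbation; its row `k` belongs to the
torus with the resonance `B k`. -/
noncomputable def resonanceMatrix : Matrix s s ℂ := fun k k' =>
  ∏ i, modeCoeff (v i) (level hv μ he (sq_cast_pos (hB k)) i) (k'.1 i) (k.1 i)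

lemma measurable_det_resonanceMatrix :
    Measurable fun μ => (resonanceMatrix hv he hB s μ).det := by
  simp only [Matrix.det_apply, resonanceMatrix]
  refine Finset.measurable_fun_sum _ fun σ _ => Measurable.const_smul
    (Finset.measurable_fun_prod _ fun k _ => Finset.measurable_fun_prod _ fun i _ => ?_) _
  exact (continuous_modeCoeff (hv i).continuous (hv i).nonneg _ _).measurable.comp
    (measurable_level hv he _ i)

lemma analyticAt_det_resonanceMatrix {m : ℝ → Fin d → ℝ} {t₀ : ℝ}
    (hm : ∀ i, (∀ᶠ t in 𝓝 t₀, m t i = 0) ∨ (0 < m t₀ i ∧ AnalyticAt ℝ (fun t => m t i) t₀)) :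
    AnalyticAt ℝ (fun t => (resonanceMatrix hv he hB s (m t)).det) t₀ := by
  simp only [Matrix.det_apply', resonanceMatrix]
  refine Finset.univ.analyticAt_fun_sum fun σ _ => ?_
  refine analyticAt_const.mul (Finset.univ.analyticAt_fun_prod fun k _ =>
    Finset.univ.analyticAt_fun_prod fun i _ => ?_)
  exact analyticAt_modeCoeff_level hv he _ hm i _ _

/-- The identity matrix is a product of Kronecker deltas over the coordinates. Each non-flat factor
differs from its delta by at most `(1 + 2πD) 2η`, flat factors not at all; diagonal dominance then
applies. -/
lemma det_resonanceMatrix_ne_zero {S : Set (Fin d)} {D : ℕ} {C : Fin d → ℝ} {κ η : ℝ}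
    (hμ : ∀ i, 0 ≤ μ i) (hflat : ∀ i ∉ S, μ i = 0) (hC : ∀ i x, v i x ≤ C i) (hκ : 0 < κ)
    (hη0 : 0 ≤ η) (hη : η ≤ 1 / 2) (hsmall : ∀ i ∈ S, μ i * C i ≤ η * (e * κ))
    (hBκ : ∀ k ∈ s, ∀ i ∈ S, κ * ∑ j, (B k j : ℝ) ^ 2 ≤ (B k i : ℝ) ^ 2)
    (hD : ∀ k ∈ s, ∀ i ∈ S, |k i| ≤ D)
    (hcard : s.card * (d * ((1 + 2 * Real.pi * D) * (2 * η))) < 1) :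
    (resonanceMatrix hv he hB s μ).det ≠ 0 := by
  refine det_ne_zero_of_norm_sub_one_le _ (θ := d * ((1 + 2 * Real.pi * D) * (2 * η)))
    (by rwa [Fintype.card_coe]) fun k k' => ?_
  have hone : (1 : Matrix s s ℂ) k k' = ∏ i, (if k'.1 i = k.1 i then 1 else 0 : ℂ) := by
    by_cases h : k = k'
    · subst h; simp
    · obtain ⟨i, hi⟩ := Function.ne_iff.1 fun h' => h (Subtype.ext h')
      rw [Matrix.one_apply_ne h]
      exact (Finset.prod_eq_zero (Finset.mem_univ i) (if_neg fun h' => hi h'.symm)).symm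
  rw [hone, resonanceMatrix]
  refine (norm_prod_sub_prod_le_sum _ _ _ (fun i _ => norm_modeCoeff_le_one (hv i).continuous
    (hv i).nonneg (hv i).periodic _ _ _) fun i _ => by split_ifs <;> simp).trans ?_
  have hpos : 0 ≤ (1 + 2 * Real.pi * D) * (2 * η) := by positivity
  calc _ ≤ ∑ _i : Fin d, (1 + 2 * Real.pi * D) * (2 * η) := Finset.sum_le_sum fun i _ => ?_
    _ = d * ((1 + 2 * Real.pi * D) * (2 * η)) := by simp
  by_cases hi : i ∈ S
  · have h1 := level_mul_le hv μ he (sq_cast_pos (hB k)) (hμ i) (hC i) hκ (hBκ k k.2 i hi) hη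
      (hsmall i hi)
    have hl := level_nonneg hv μ he (sq_cast_pos (hB k)) i
    refine (norm_modeCoeff_sub_le (hv i).continuous (hv i).nonneg hl (hC i) _ _).trans ?_
    have h2 : |((k.1 i : ℤ) : ℝ)| ≤ D := by exact_mod_cast hD k k.2 i hi
    have h3 : 0 ≤ level hv μ he (sq_cast_pos (hB k)) i * C i :=
      mul_nonneg hl (((hv i).nonneg 0).trans (hC i 0))
    gcongr
  · rw [level_of_eq_zero hv μ he _ (hflat i hi), modeCoeff_of_nonpos _ le_rfl, sub_self, norm_zero]
    exact hpos

end ResonanceMatrix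

/-! ### From non-degenerate systems to vanishing Fourier coefficients -/

section Rigidity

variable {d : ℕ}

/-- If the linear systems for the Fourier coefficients are non-degenerate, preserved integrability
implies that the spectrum of `U` contains no element with two non-zero entries. -/
lemma fourierCoeff_eq_zero_of_isPreserved [Nonempty (Fin d)] {V : Fin d → UnitAddCircle → ℝ}
    {μ : Fin d → ℝ} {e : ℝ} {U : UnitAddTorus (Fin d) → ℝ} (hV : ∀ i, IsProfile (lift₁ (V i)))
    (he : 0 < e) (hμ : ∀ i, 0 ≤ μ i) (hU : IsPerturbation U) {S : Set (Fin d)} {D : ℕ}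
    (hD : ∀ k ∈ spectrumSet U, ∀ i ∈ S, |k i| ≤ D) (hflat : ∀ i ∉ S, μ i = 0)
    {B : (Fin d → ℤ) → Fin d → ℤ} (hB : ∀ k i, B k i ≠ 0) (k₀ : Fin d → ℤ)
    (horth : ∀ k ∈ fiber U D S k₀, ∑ i, B k i * k i = 0)
    (hpres : ∀ k ∈ fiber U D S k₀, ∃ ε : ℕ → ℝ, (∀ n, ε n ≠ 0) ∧ Tendsto ε atTop (𝓝 0) ∧
      ∃ c, IsResonantTorus V μ e (B k) c ∧ IsPreserved V μ U ε c)
    (hdet : (resonanceMatrix hV he hB (fiber U D S k₀) μ).det ≠ 0) {k : Fin d → ℤ}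
    (hk : k ∈ fiber U D S k₀) : k ∉ spectrumSet U := by
  set c := UnitAddTorus.mFourierCoeff fun x => (U x : ℂ) with hc
  set s := fiber U D S k₀ with hs
  have hsys : (resonanceMatrix hV he hB s μ).mulVec (fun k => c k.1) = 0 := by
    funext k
    obtain ⟨ε, hε, hε0, x, hres, hpr⟩ := hpres k k.2
    obtain ⟨hkD, hkf, -, i₁, i₂, hne, h1, h2⟩ := mem_fiber.1 k.2
    obtain ⟨a, ha⟩ := exists_average_eq (Fin.pos i₁) hV he hμ hU.continuous (hB k)
      (sq_cast_pos (hB k)) (fun _ => rfl) hres hpr hε hε0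
    have hk0 : k.1 ≠ 0 := fun h => h1 (by rw [h]; rfl)
    have hsum := hU.hasSum_prod_modeCoeff hV
      (fun i => level hV μ he (sq_cast_pos (hB k)) i) (horth k k.2) hk0 ha
    -- A term survives only if its flat entries agree with those of `k`, hence of `k₀`, and its
    -- entries at `i₁`, `i₂` are non-zero. So the infinite sum runs over the fiber.
    have hfin := hasSum_sum_of_ne_finset_zero
      (L := SummationFilter.unconditional _) (s := s) (f := fun k' => c k' *
      ∏ i, modeCoeff (lift₁ (V i)) (level hV μ he (sq_cast_pos (hB k)) i) (k' i) (k.1 i))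
      fun k' hk' => by
        by_contra hne0
        obtain ⟨hc0, hp0⟩ := mul_ne_zero_iff.1 hne0
        rw [Finset.prod_ne_zero_iff] at hp0
        refine hk' (mem_fiber.2 ⟨hD k' hc0, fun i hi => ?_, hc0, i₁, i₂, hne, ?_, ?_⟩)
        · by_contra hne'
          refine hp0 i (Finset.mem_univ i) ?_
          rw [level_of_eq_zero hV μ he _ (hflat i hi), modeCoeff_of_nonpos _ le_rfl, hkf i hi,
            if_neg hne']
        · intro h
          refine hp0 i₁ (Finset.mem_univ i₁) ?_
          rw [h, modeCoeff_zero_left (hV i₁).continuous (hV i₁).nonneg, if_neg h1]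
        · intro h
          refine hp0 i₂ (Finset.mem_univ i₂) ?_
          rw [h, modeCoeff_zero_left (hV i₂).continuous (hV i₂).nonneg, if_neg h2]
    have h3 := hfin.unique hsum
    rw [← Finset.sum_coe_sort] at h3
    rw [Pi.zero_apply, ← h3, Matrix.mulVec, dotProduct]
    exact Finset.sum_congr rfl fun k' _ => mul_comm _ _
  have h := congrFun (Matrix.eq_zero_of_mulVec_eq_zero hdet hsys) ⟨k, hk⟩
  exact fun h' => h' h

/-- The vector of parameters with given intermediate and analytic entries and vanishing flat
entries. -/
noncomputable def parameters {dflat danlyt : ℕ} (s : MidIndex d dflat danlyt → ℝ)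
    (a : AnalyticIndex d danlyt → ℝ) (i : Fin d) : ℝ :=
  if h : dflat ≤ (i : ℕ) ∧ (i : ℕ) + danlyt < d then s ⟨i, h⟩
  else if h : d ≤ (i : ℕ) + danlyt then a ⟨i, h⟩ else 0

lemma measurable_parameters {dflat danlyt : ℕ} (s : MidIndex d dflat danlyt → ℝ) :
    Measurable fun a : AnalyticIndex d danlyt → ℝ => parameters s a := by
  refine measurable_pi_lambda _ fun i => ?_
  unfold parameters
  split_ifs <;> fun_prop

lemma parameters_eq {dflat danlyt : ℕ} {μ : Fin d → ℝ}
    (hμ : ∀ i : Fin d, (i : ℕ) < dflat → μ i = 0) :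
    parameters (fun k : MidIndex d dflat danlyt => μ k)
      (fun j : AnalyticIndex d danlyt => μ j) = μ := by
  funext i
  unfold parameters
  split_ifs with h1 h2
  · rfl
  · rfl
  · exact (hμ i (by omega)).symm

end Rigidity

end LiouvilleRigidity

/-! ### The main theorem -/

open LiouvilleRigidity in
theorem mainTheorem4 (d dflat danlyt : ℕ) (hd : 1 ≤ d) (hsum : dflat + danlyt ≤ d)
    (e : ℝ) (he : 0 < e) (deg : Fin d → ℕ) :
    ∃ τ : Fin d → ℝ → ℝ, (∀ k C, 0 < τ k C) ∧
      ∀ (C : Fin d → ℝ) (V : Fin d → UnitAddCircle → ℝ) (U : UnitAddTorus (Fin d) → ℝ)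
        (μmax : Fin d → ℝ),
        (∀ i, LiouvilleRigidity.IsPotential (V i) (C i)) →
        (∀ j : LiouvilleRigidity.AnalyticIndex d danlyt, LiouvilleRigidity.IsAnalytic (V j)) →
        LiouvilleRigidity.IsPerturbation U →
        (∀ i : Fin d, dflat ≤ (i : ℕ) → LiouvilleRigidity.HasDegree U i (deg i)) →
        (∀ i, 0 ≤ μmax i) →
        (∀ i : Fin d, (i : ℕ) < dflat → μmax i = 0) →
        (∀ k : LiouvilleRigidity.MidIndex d dflat danlyt, μmax k ≤ τ k (C k)) →
        ∃ N : (LiouvilleRigidity.MidIndex d dflat danlyt → ℝ) →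
            Set (LiouvilleRigidity.AnalyticIndex d danlyt → ℝ),
          (∀ s, MeasureTheory.volume (N s) = 0) ∧
          ∀ Λ ⊆ Set.Icc (0 : Fin d → ℝ) μmax,
            LiouvilleRigidity.PreservesIntegrability V U e Λ →
            ∀ μ ∈ Λ, (fun j : LiouvilleRigidity.AnalyticIndex d danlyt => μ j) ∉
                N (fun k : LiouvilleRigidity.MidIndex d dflat danlyt => μ k) →
              LiouvilleRigidity.IsSeparable U := by
  have hne : Nonempty (Fin d) := ⟨⟨0, hd⟩⟩
  set D := Finset.univ.sup deg with hDdef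
  set M : ℕ := 4 * d ^ 3 * (D + 1) ^ 2 with hM
  have hM0 : 0 < M := by positivity
  set κ : ℝ := (M : ℝ)⁻¹ with hκ
  have hκ0 : 0 < κ := by positivity
  -- Chosen so that the bound on the cardinality of a fiber times the entrywise distance to the
  -- identity is `1/2`.
  set η : ℝ := (4 * (d * ((1 + 2 * Real.pi * D) * (2 * D + 1) ^ d)))⁻¹ with hη
  have hd1 : (1 : ℝ) ≤ d := by exact_mod_cast hd
  have hη0 : 0 < η := by positivity
  have hη2 : η ≤ 1 / 2 := by
    have h1 : (1 : ℝ) ≤ 1 + 2 * Real.pi * D := le_add_of_nonneg_right (by positivity)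
    have h2 : (1 : ℝ) ≤ (2 * (D : ℝ) + 1) ^ d :=
      one_le_pow₀ (le_add_of_nonneg_left (by positivity))
    rw [hη, one_div]
    refine inv_anti₀ two_pos ?_
    have h3 := one_le_mul_of_one_le_of_one_le hd1 (one_le_mul_of_one_le_of_one_le h1 h2)
    linarith
  set S : Set (Fin d) := {i | dflat ≤ (i : ℕ)} with hS
  have hres : ∀ k : Fin d → ℤ, ∃ b : Fin d → ℤ, (∀ i, b i ≠ 0) ∧
      ((∃ i j, i ≠ j ∧ k i ≠ 0 ∧ k j ≠ 0) → (∀ i ∈ S, |k i| ≤ D) →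
        Finset.univ.gcd b = 1 ∧ ∑ i, b i * k i = 0 ∧
          ∀ i ∈ S, ∑ j, b j ^ 2 ≤ (M : ℤ) * b i ^ 2) := by
    intro k
    by_cases h : (∃ i j, i ≠ j ∧ k i ≠ 0 ∧ k j ≠ 0) ∧ ∀ i ∈ S, |k i| ≤ D
    · obtain ⟨b, h1, h2, h3, h4⟩ := exists_resonance h.1 h.2
      exact ⟨b, h2, fun _ _ => ⟨h1, h3, h4⟩⟩
    · exact ⟨1, fun _ => one_ne_zero, fun h1 h2 => absurd ⟨h1, h2⟩ h⟩
  choose B hB hBres using hres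
  -- The `+ 1` keeps the threshold finite and positive when the bound on the potential is zero.
  refine ⟨fun _ C => η * (e * κ) / (|C| + 1), fun _ C => by positivity, ?_⟩
  intro C V U μmax hV _ hU hdeg hμmax hμflat hμτ
  have hP : ∀ i, IsProfile (lift₁ (V i)) := fun i => (hV i).isProfile
  have hVC : ∀ i x, lift₁ (V i) x ≤ C i := fun i x =>
    (le_abs_self _).trans ((hV i).norm_le _)
  have hD : ∀ k ∈ spectrumSet U, ∀ i ∈ S, |k i| ≤ D := fun k hk i hi => by
    refine ((hdeg i hi).1 k hk).trans ?_
    exact_mod_cast Finset.le_sup (f := deg) (Finset.mem_univ i)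
  have hfib : ∀ k₀, ∀ k ∈ fiber U D S k₀, Finset.univ.gcd (B k) = 1 ∧ ∑ i, B k i * k i = 0 ∧
      ∀ i ∈ S, ∑ j, B k j ^ 2 ≤ (M : ℤ) * B k i ^ 2 := fun k₀ k hk =>
    hBres k (mem_fiber.1 hk).2.2.2 (mem_fiber.1 hk).1
  have hsmallτ : ∀ i (x : ℝ), x ≤ η * (e * κ) / (|C i| + 1) → 0 ≤ x → x * C i ≤ η * (e * κ) := by
    intro i x hx hx0
    rw [le_div_iff₀ (by positivity)] at hx
    have h1 := mul_le_mul_of_nonneg_left (le_abs_self (C i)) hx0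
    linarith
  have hdet : ∀ (k₀ : Fin d → ℤ) (μ : Fin d → ℝ), (∀ i, 0 ≤ μ i) → (∀ i ∉ S, μ i = 0) →
      (∀ i ∈ S, μ i ≤ η * (e * κ) / (|C i| + 1)) →
      (resonanceMatrix hP he hB (fiber U D S k₀) μ).det ≠ 0 := by
    intro k₀ μ h0 hfl hsm
    refine det_resonanceMatrix_ne_zero hP he hB _ μ h0 hfl hVC hκ0 hη0.le hη2
      (fun i hi => hsmallτ i _ (hsm i hi) (h0 i)) (fun k hk i hi => ?_)
      (fun k hk => (mem_fiber.1 hk).1) ?_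
    · have h1 : (∑ j, (B k j : ℝ) ^ 2) ≤ M * (B k i : ℝ) ^ 2 := by
        exact_mod_cast (hfib k₀ k hk).2.2 i hi
      have hM0' : (0 : ℝ) < M := by exact_mod_cast hM0
      rw [hκ, inv_mul_le_iff₀ hM0']
      exact h1
    · have h1 : ((fiber U D S k₀).card : ℝ) ≤ (2 * (D : ℝ) + 1) ^ d := by
        exact_mod_cast card_fiber_le
      calc _ ≤ (2 * (D : ℝ) + 1) ^ d * (d * ((1 + 2 * Real.pi * D) * (2 * η))) := by gcongr
        _ = 1 / 2 := by rw [hη]; field_simp; norm_num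
        _ < 1 := by norm_num
  -- The bad analytic parameters for one fiber. When there are no analytic indices, a null set in
  -- the zero-dimensional space is empty.
  set Z : (MidIndex d dflat danlyt → ℝ) → (Fin d → ℤ) → Set (AnalyticIndex d danlyt → ℝ) :=
    fun s k₀ => {a | (∀ j, 0 ≤ a j) ∧
      (resonanceMatrix hP he hB (fiber U D S k₀) (parameters s a)).det = 0} with hZ
  have hZ0 : ∀ s k₀, (∀ k : MidIndex d dflat danlyt, 0 ≤ s k ∧ s k ≤ μmax k) →
      volume (Z s k₀) = 0 := by
    intro s k₀ hs
    have hmeas : MeasurableSet (Z s k₀) := by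
      have h1 := (measurable_det_resonanceMatrix hP he hB (fiber U D S k₀)).comp
        (measurable_parameters (danlyt := danlyt) s)
      refine MeasurableSet.inter ?_ (h1 (measurableSet_singleton 0))
      exact measurableSet_Ici (a := (0 : AnalyticIndex d danlyt → ℝ))
    refine volume_eq_zero_of_rays hmeas fun x => ?_
    by_cases hx : ∀ j, 0 ≤ x j
    · have han : ∀ t : ℝ, 0 < t → AnalyticAt ℝ (fun t : ℝ =>
          (resonanceMatrix hP he hB (fiber U D S k₀) (parameters s (t • x))).det) t := fun t ht => by
        refine analyticAt_det_resonanceMatrix hP he hB _ fun i => ?_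
        unfold parameters
        split_ifs with h1 h2
        · rcases (hs ⟨i, h1⟩).1.eq_or_lt with h | h
          · exact Or.inl (Eventually.of_forall fun _ => h.symm)
          · exact Or.inr ⟨h, analyticAt_const⟩
        · rcases (hx ⟨i, h2⟩).eq_or_lt with h | h
          · exact Or.inl (Eventually.of_forall fun t => by simp [← h])
          · exact Or.inr ⟨mul_pos ht h, analyticAt_id.mul analyticAt_const⟩
        · exact Or.inl (Eventually.of_forall fun _ => rfl)
      -- Close to the origin of the ray the analytic parameters satisfy the smallness thresholds
      -- too, so the determinant is non-zero at some point of the ray.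
      have hsmall : ∃ t : ℝ, 0 < t ∧ ∀ j : AnalyticIndex d danlyt,
          t * x j ≤ η * (e * κ) / (|C j| + 1) := by
        have h1 : ∀ᶠ t in 𝓝[>] (0 : ℝ), ∀ j : AnalyticIndex d danlyt,
            t * x j ≤ η * (e * κ) / (|C j| + 1) := by
          refine eventually_all.2 fun j => ?_
          have h2 : Tendsto (fun t => t * x j) (𝓝[>] 0) (𝓝 (0 * x j)) :=
            (tendsto_id.mul_const (x j)).mono_left nhdsWithin_le_nhds
          rw [zero_mul] at h2
          exact (h2.eventually (gt_mem_nhds (by positivity))).mono fun t ht => ht.le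
        obtain ⟨t, h2, h3⟩ := (h1.and self_mem_nhdsWithin).exists
        exact ⟨t, h3, h2⟩
      obtain ⟨t₁, ht₁, ht₁s⟩ := hsmall
      have hne1 := hdet k₀ (parameters s (t₁ • x)) (fun i => by
          unfold parameters
          split_ifs with h1 h2
          · exact (hs _).1
          · exact mul_nonneg ht₁.le (hx _)
          · exact le_rfl) (fun i hi => by
          have hi' : ¬ dflat ≤ (i : ℕ) := hi
          unfold parameters
          rw [dif_neg fun h => hi' h.1, dif_neg (by omega)]) fun i hi => by
          unfold parameters
          split_ifs with h1 h2
          · exact (hs ⟨i, h1⟩).2.trans (hμτ ⟨i, h1⟩)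
          · exact ht₁s ⟨i, h2⟩
          · positivity
      filter_upwards [ae_ne_zero_of_analyticAt han ht₁ hne1] with t ht hmem using ht hmem.2
    -- A direction with a negative entry never meets `Z`.
    · filter_upwards [ae_restrict_mem measurableSet_Ioi] with t ht hmem
      exact hx fun j => nonneg_of_mul_nonneg_right (hmem.1 j) ht
  -- A countable union over base points `k₀`; for `s` outside the box the set is taken empty, as no
  -- `μ ∈ Λ` has such intermediate entries.
  refine ⟨fun s => {a | (∀ k, 0 ≤ s k ∧ s k ≤ μmax k) ∧ a ∈ ⋃ k₀, Z s k₀}, fun s => ?_, ?_⟩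
  · by_cases hs : ∀ k, 0 ≤ s k ∧ s k ≤ μmax k
    · exact measure_mono_null (fun a ha => ha.2) (measure_iUnion_null fun k₀ => hZ0 s k₀ hs)
    · exact measure_mono_null (fun a ha => hs ha.1) measure_empty
  intro Λ hΛ hpres μ hμΛ hμN
  have hμ0 : ∀ i, 0 ≤ μ i := (hΛ hμΛ).1
  have hμfl : ∀ i : Fin d, (i : ℕ) < dflat → μ i = 0 := fun i hi =>
    le_antisymm (((hΛ hμΛ).2 i).trans_eq (hμflat i hi)) (hμ0 i)
  refine hU.isSeparable hd fun k₀ hk₀ i j hi hj => ?_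
  by_contra hij
  -- An off-axis spectral mode lies in its own fiber, whose coefficients are all forced to vanish.
  have hk₀f : k₀ ∈ fiber U D S k₀ :=
    mem_fiber.2 ⟨hD k₀ hk₀, fun _ _ => rfl, hk₀, i, j, hij, hi, hj⟩
  refine fourierCoeff_eq_zero_of_isPreserved hP he hμ0 hU hD
    (fun i hi => hμfl i (not_le.1 hi)) hB k₀ (fun k hk => (hfib k₀ k hk).2.1)
    (fun k hk => ?_) (fun h0 => hμN ?_) hk₀f hk₀
  · obtain ⟨-, -, hks, i₁, -, -, h1, -⟩ := mem_fiber.1 hk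
    obtain ⟨ε, hε, hε0, h⟩ := hpres (B k)
      ⟨⟨k, hks, fun h => h1 (by rw [h]; rfl), (hfib k₀ k hk).2.1⟩, (hfib k₀ k hk).1, hB k⟩
    exact ⟨ε, hε, hε0, h μ hμΛ⟩
  · refine ⟨fun k => ⟨hμ0 k, (hΛ hμΛ).2 k⟩, Set.mem_iUnion.2 ⟨k₀, fun j => hμ0 j, ?_⟩⟩
    rw [parameters_eq hμfl]
    exact h0
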